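/- Let $n\ge 1$, $\nu,\lambda>0$, $p,q,\beta\in[2,\infty]$, with $p',q'$ the conjugate exponents of $p,q$. Let $\Omega\subset\mathbb R^n$ be a bounded domain with $C^1$ boundary $\partial\Omega=\Gamma_u\cup\Gamma_t$ and outward unit normal $\vec n$; let $d\Gamma$ be surface measure. Put $$\mathcal U_0=\Big\{u\in L^p(\Omega):\ \nabla u\in L^4(\Omega)^n,\ u=0\text{ on }\Gamma_u,\ \Delta u\in L^{2p'/(2-p')}(\Omega),\ u|_{\Gamma_t}\in L^q(\Gamma_t),\ \tfrac{\partial u}{\partial \vec n}\big|_{\Gamma_t}\in L^\beta(\Gamma_t)\Big\}$$ (weak derivatives, boundary values as traces; the exponent is $\infty$ for $p=2$). For $f\in L^{p'}(\Omega)$, $t\in L^{q'}(\Gamma_t)$ let $$P_n(u)=\int_\Omega \frac{\nu}{2}\Big(\frac12|\nabla u|^2-\lambda\Big)^2dx-\int_\Omega fu\,dx-\int_{\Gamma_t}tu\,d\Gamma .$$ Let $\vec\sigma$ be a vector field, continuous on $\overline\Omega$, that solves $\nabla\cdot\vec\sigma+f=0$ in $\Omega$, $\vec\sigma\cdot\vec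 n=t$ on $\Gamma_t$ weakly, i.e. $\int_\Omega\vec\sigma\cdot\nabla v\,dx=\int_\Omega fv\,dx+\int_{\Gamma_t}tv\,d\Gamma$ for all $v\in\mathcal U_0$. Let $$P_n^d(\zeta)=-\frac12\int_\Omega\Big(\frac{|\vec\sigma|^2}{\zeta}+2\lambda\zeta+\frac{\zeta^2}{\nu}\Big)dx\in[-\infty,\infty]$$ for $\zeta\in L^2(\Omega)$ of constant sign, with $|\vec\sigma|^2/0=+\infty$ for $\vec\sigma\ne0$, and $\mathcal E=\{\zeta\in L^2(\Omega):\zeta\ge0\}$. The dual algebraic equation (DAE) at $x$ is $|\vec\sigma(x)|^2=2\zeta^2(\lambda+\zeta/\nu)$, $\zeta\in\mathbb R$. For a function $\zeta$ of its roots, a *solution corresponding to* $\zeta$ is a $u\in\mathcal U_0$ with $$u(x)=\int_{x_0}^x\zeta^{-1}\vec\sigma\cdot d\vec s+u(x_0)\qquad(x_0,x\in\Omega)$$ along every $C^1$ path in $\Omega$. Local extrema of $P_n$ are weak ones: $u_0\in\mathcal U_0$ is a local minimizer (maximizer) if for some $\delta>0$ it minimizes (maximizes) $P_n$ among all $u\in\mathcal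 U_0$ with $|u-u_0|<\delta$ and $|\nabla u-\nabla u_0|<\delta$ a.e. in $\Omega$. (1) If $|\vec\sigma(x)|^2>8\lambda^3\nu^2/27$ for all $x\in\overline\Omega$, then the DAE has at each $x\in\overline\Omega$ a unique real root $\bar\zeta(x)$, and $\bar\zeta(x)>0$; $\bar\zeta\in\mathcal E$ is a global maximizer of $P_n^d$ over $\mathcal E$, and every solution $\bar u$ corresponding to $\bar\zeta$ is a global minimizer of $P_n$ over $\mathcal U_0$, with $P_n(\bar u)=\min_{\mathcal U_0}P_n=\max_{\mathcal E}P_n^d=P_n^d(\bar\zeta)$. (2) If $0<|\vec\sigma(x)|^2<8\lambda^3\nu^2/27$ for all $x\in\overline\Omega$, then the DAE has at each $x\in\overline\Omega$ exactly three real roots, with $$\bar\zeta_1(x)>0>\bar\zeta_2(x)>-\tfrac{2\nu\lambda}{3}>\bar\zeta_3(x)>-\nu\lambda .$$ Moreover: (a) $\bar\zeta_1$ maximizes $P_n^d$ over $\{\zeta\in L^2(\Omega):\zeta>0\}$; every solution $\bar u_1$ corresponding to $\bar\zeta_1$ minimizes $P_n$, over all of $\mathcal U_0$ and hence over every neighbourhood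 of $\bar u_1$ in $\mathcal U_0$; and $P_n(\bar u_1)=P_n^d(\bar\zeta_1)$. (b) $\bar\zeta_3$ maximizes $P_n^d$ over $\{\zeta\in L^2(\Omega):-\nu\lambda<\zeta<-2\nu\lambda/3\}$; every solution $\bar u_3$ corresponding to $\bar\zeta_3$ is a local maximizer of $P_n$; and $P_n(\bar u_3)=P_n^d(\bar\zeta_3)$. (c) If $n=1$, then $\bar\zeta_2$ minimizes $P_n^d$ over $\{\zeta\in L^2(\Omega):-2\nu\lambda/3<\zeta<0\}$; every solution $\bar u_2$ corresponding to $\bar\zeta_2$ is a local minimizer of $P_n$; and $P_n(\bar u_2)=P_n^d(\bar\zeta_2)$. (d) If $n\ge2$, a solution $\bar u_2$ corresponding to $\bar\zeta_2$ need not be a local minimizer: for all $n\ge 2$ and $\nu,\lambda,p,q,\beta$ as above there are a simply connected $\Omega$ and $\Gamma_u,\Gamma_t,f,t,\vec\sigma$ as in (2), and a solution $\bar u_2$ corresponding to $\bar\zeta_2$, that is not a local minimizer of $P_n$. -/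

import Mathlib

open MeasureTheory Set Topology
open scoped ENNReal ContDiff RealInnerProductSpace

noncomputable section

namespace DoubleWell

/-- The space `ℝⁿ` with its Euclidean norm. -/
abbrev E (n : ℕ) := EuclideanSpace ℝ (Fin n)

/-- The `i`-th partial derivative. -/
def partialD {n : ℕ} (φ : E n → ℝ) (i : Fin n) (x : E n) : ℝ :=
  fderiv ℝ φ x (EuclideanSpace.single i 1)

/-- The divergence of a vector field. -/
def divergence {n : ℕ} (φ : E n → E n) (x : E n) : ℝ :=
  ∑ i, (fderiv ℝ φ x (EuclideanSpace.single i 1)) i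

/-- A bounded domain of `ℝⁿ` with `C¹` boundary, its outward unit normal field, and a covering of
the boundary by a Dirichlet part `Γu` and a Neumann part `Γt`. -/
structure BoundaryDomain (n : ℕ) where
  Ω : Set (E n)
  /-- outward unit normal on the boundary -/
  normal : E n → E n
  Γu : Set (E n)
  Γt : Set (E n)
  isOpen : IsOpen Ω
  isConnected : IsConnected Ω
  isBounded : Bornology.IsBounded Ω
  /-- Near each boundary point, `Ω` is the sublevel set `{ψ < 0}` of a `C¹` function whose gradient
  does not vanish on the boundary, and the outward unit normal is the normalized gradient of `ψ`. -/
  boundary : ∀ x ∈ frontier Ω, ∃ U ∈ 𝓝 x, ∃ ψ : E n → ℝ, ContDiff ℝ 1 ψ ∧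
    (∀ y ∈ U, y ∈ Ω ↔ ψ y < 0) ∧
    ∀ y ∈ U ∩ frontier Ω, ψ y = 0 ∧ gradient ψ y ≠ 0 ∧
      normal y = ‖gradient ψ y‖⁻¹ • gradient ψ y
  measurableSet_Γu : MeasurableSet Γu
  measurableSet_Γt : MeasurableSet Γt
  union_eq : Γu ∪ Γt = frontier Ω

/-- The `(n-1)`-dimensional surface measure: Hausdorff measure in the normalization that agrees with
Lebesgue measure in dimension `n - 1` (for `n = 1`, the counting measure). -/
def surface (n : ℕ) : Measure (E n) := μHE[n - 1]

/-- `G` is the weak gradient of `u` in `Ω`. -/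
def IsWeakGradient {n : ℕ} (Ω : Set (E n)) (u : E n → ℝ) (G : E n → E n) : Prop :=
  ∀ φ : E n → ℝ, ContDiff ℝ ∞ φ → HasCompactSupport φ → tsupport φ ⊆ Ω →
    ∀ i, ∫ x in Ω, u x * partialD φ i x = - ∫ x in Ω, G x i * φ x

/-- `L` is the weak Laplacian in `Ω` of a function with weak gradient `G`. -/
def IsWeakLaplacian {n : ℕ} (Ω : Set (E n)) (G : E n → E n) (L : E n → ℝ) : Prop :=
  ∀ φ : E n → ℝ, ContDiff ℝ ∞ φ → HasCompactSupport φ → tsupport φ ⊆ Ω →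
    ∫ x in Ω, fderiv ℝ φ x (G x) = - ∫ x in Ω, L x * φ x

/-- `w` is the boundary trace of a function `u` with weak gradient `G`, characterized by Green's
formula against all smooth vector fields on `ℝⁿ` with compact support. -/
def IsTrace {n : ℕ} (D : BoundaryDomain n) (u : E n → ℝ) (G : E n → E n) (w : E n → ℝ) : Prop :=
  Integrable w ((surface n).restrict (frontier D.Ω)) ∧
  ∀ φ : E n → E n, ContDiff ℝ ∞ φ → HasCompactSupport φ →
    ∫ x in D.Ω, (u x * divergence φ x + ⟪G x, φ x⟫) =
      ∫ x in frontier D.Ω, w x * ⟪φ x, D.normal x⟫ ∂(surface n)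

/-- `g` is the normal derivative on `Γt` of a function with weak gradient `G` and weak
Laplacian `L`, characterized by Green's formula against smooth functions supported away
from `Γu`. -/
def IsNormalDerivative {n : ℕ} (D : BoundaryDomain n) (G : E n → E n) (L g : E n → ℝ) : Prop :=
  Integrable g ((surface n).restrict D.Γt) ∧
  ∀ φ : E n → ℝ, ContDiff ℝ ∞ φ → HasCompactSupport φ → Disjoint (tsupport φ) D.Γu →
    ∫ x in D.Ω, (fderiv ℝ φ x (G x) + L x * φ x) = ∫ x in D.Γt, g x * φ x ∂(surface n)

/-- An element of `𝓤 = {u ∈ Lᵖ(Ω) : u = 0 on Γu, ∇u ∈ L⁴(Ω)ⁿ}`: a function together with its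
weak gradient and its boundary trace, both of which it determines almost everywhere. -/
structure SpaceU {n : ℕ} (D : BoundaryDomain n) (p : ℝ≥0∞) where
  toFun : E n → ℝ
  grad : E n → E n
  trace : E n → ℝ
  memLp : MemLp toFun p (volume.restrict D.Ω)
  grad_memLp : MemLp grad 4 (volume.restrict D.Ω)
  isWeakGradient : IsWeakGradient D.Ω toFun grad
  isTrace : IsTrace D toFun grad trace
  trace_eq_zero : ∀ᵐ x ∂((surface n).restrict D.Γu), trace x = 0

/-- The conjugate exponent `p'`, with `1/p + 1/p' = 1`. -/
abbrev conj (p : ℝ≥0∞) : ℝ≥0∞ := ENNReal.conjExponent p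

/-- An element of `𝓤₀ = {u ∈ 𝓤 : Δu ∈ L^{2p'/(2-p')}(Ω), u ∈ L^q(Γt), ∂u/∂n ∈ L^β(Γt)}`, together
with its Laplacian and normal derivative, which it determines almost everywhere. For `p = 2`, where
`p' = 2`, the exponent `2p'/(2-p')` is `∞`, as division by `0` gives in `ℝ≥0∞`. -/
structure SpaceU0 {n : ℕ} (D : BoundaryDomain n) (p q β : ℝ≥0∞) extends SpaceU D p where
  lap : E n → ℝ
  normalDeriv : E n → ℝ
  isWeakLaplacian : IsWeakLaplacian D.Ω grad lap
  lap_memLp : MemLp lap (2 * conj p / (2 - conj p)) (volume.restrict D.Ω)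
  isNormalDerivative : IsNormalDerivative D grad lap normalDeriv
  normalDeriv_memLp : MemLp normalDeriv β ((surface n).restrict D.Γt)
  trace_memLp : MemLp trace q ((surface n).restrict D.Γt)

/-- The double-well potential `W(y) = ν/2 (|y|²/2 - lam)²`. -/
def W {n : ℕ} (ν lam : ℝ) (y : E n) : ℝ := ν / 2 * (‖y‖ ^ 2 / 2 - lam) ^ 2

/-- The total potential energy
`P_n(u) = ∫_Ω W(∇u) dx - ∫_Ω f u dx - ∫_{Γt} t u dΓ`. -/
def energy {n : ℕ} {D : BoundaryDomain n} {p q β : ℝ≥0∞} (ν lam : ℝ) (f t : E n → ℝ)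
    (u : SpaceU0 D p q β) : ℝ :=
  (∫ x in D.Ω, W ν lam (u.grad x)) - (∫ x in D.Ω, f x * u.toFun x)
    - ∫ x in D.Γt, t x * u.trace x ∂(surface n)

/-- `σ` is a weak solution of `∇·σ + f = 0` in `Ω`, `σ·n = t` on `Γt`. -/
def IsEquilibrium {n : ℕ} (D : BoundaryDomain n) (p q β : ℝ≥0∞) (f t : E n → ℝ)
    (σ : E n → E n) : Prop :=
  ∀ v : SpaceU0 D p q β,
    ∫ x in D.Ω, ⟪σ x, v.grad x⟫ =
      (∫ x in D.Ω, f x * v.toFun x) + ∫ x in D.Γt, t x * v.trace x ∂(surface n)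

/-- The dual algebraic equation `|σ|² = 2 z² (lam + z/ν)` at a point where `σ` has value `s`. -/
def DAE {n : ℕ} (ν lam : ℝ) (s : E n) (z : ℝ) : Prop :=
  ‖s‖ ^ 2 = 2 * z ^ 2 * (lam + z / ν)

/-- The functions `ζ ∈ L²(Ω)` with values in `I` almost everywhere. For `I = [0, ∞)` this
is `𝓔`. -/
def dualSet {n : ℕ} (D : BoundaryDomain n) (I : Set ℝ) : Set (E n → ℝ) :=
  {ζ | MemLp ζ 2 (volume.restrict D.Ω) ∧ ∀ᵐ x ∂(volume.restrict D.Ω), ζ x ∈ I}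

/-- The pure complementary energy
`P_n^d(ζ) = -1/2 ∫_Ω (|σ|²/ζ + 2 lam ζ + ζ²/ν) dx`, with values in the extended reals: on functions
`ζ` of constant sign, the integral of `-|σ|²/(2ζ)` may be `-∞` (for `ζ ≥ 0`) or `+∞`
(for `ζ < 0`). -/
def dualEnergy {n : ℕ} (D : BoundaryDomain n) (ν lam : ℝ) (σ : E n → E n) (ζ : E n → ℝ) : EReal :=
  ((∫⁻ x in D.Ω, (if ζ x < 0 then ENNReal.ofReal (‖σ x‖ ^ 2 / 2) / ENNReal.ofReal (-ζ x) else 0)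
      : ℝ≥0∞) : EReal)
  - ((∫⁻ x in D.Ω, (if 0 ≤ ζ x then ENNReal.ofReal (‖σ x‖ ^ 2 / 2) / ENNReal.ofReal (ζ x) else 0)
      : ℝ≥0∞) : EReal)
  - ((∫ x in D.Ω, (lam * ζ x + ζ x ^ 2 / (2 * ν)) : ℝ) : EReal)

/-- `u(x) = ∫_{x₀}^x ζ⁻¹ σ · ds + u(x₀)` for all `x₀, x ∈ Ω`, the integral being taken along any
`C¹` path from `x₀` to `x` in `Ω`. -/
def IsPathIntegral {n : ℕ} (Ω : Set (E n)) (σ : E n → E n) (ζ : E n → ℝ) (u : E n → ℝ) : Prop :=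
  ∀ (x₀ x : E n) (γ : Path x₀ x), ContDiffOn ℝ 1 γ.extend (Icc 0 1) → (∀ s, γ s ∈ Ω) →
    u x = curveIntegral (fun y => innerSL ℝ ((ζ y)⁻¹ • σ y)) γ + u x₀

/-- `u` lies within `δ` of `u₀` in `W^{1,∞}(Ω)`. -/
def Near {n : ℕ} {D : BoundaryDomain n} {p q β : ℝ≥0∞} (δ : ℝ) (u₀ u : SpaceU0 D p q β) : Prop :=
  ∀ᵐ x ∂(volume.restrict D.Ω), |u.toFun x - u₀.toFun x| < δ ∧ ‖u.grad x - u₀.grad x‖ < δ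

/-- `u₀` minimizes `P_n` over a `W^{1,∞}`-neighbourhood of `u₀` in `𝓤₀`. -/
def IsWeakLocalMin {n : ℕ} {D : BoundaryDomain n} {p q β : ℝ≥0∞} (ν lam : ℝ) (f t : E n → ℝ)
    (u₀ : SpaceU0 D p q β) : Prop :=
  ∃ δ > 0, ∀ u : SpaceU0 D p q β, Near δ u₀ u → energy ν lam f t u₀ ≤ energy ν lam f t u

/-- `u₀` maximizes `P_n` over a `W^{1,∞}`-neighbourhood of `u₀` in `𝓤₀`. -/
def IsWeakLocalMax {n : ℕ} {D : BoundaryDomain n} {p q β : ℝ≥0∞} (ν lam : ℝ) (f t : E n → ℝ)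
    (u₀ : SpaceU0 D p q β) : Prop :=
  ∃ δ > 0, ∀ u : SpaceU0 D p q β, Near δ u₀ u → energy ν lam f t u ≤ energy ν lam f t u₀

/-- Standing assumptions on the data: `f ∈ L^{p'}(Ω)`, `t ∈ L^{q'}(Γt)`, and `σ`, continuous on the
closure of `Ω`, solves the divergence equation. -/
structure IsData {n : ℕ} (D : BoundaryDomain n) (p q β : ℝ≥0∞) (f t : E n → ℝ)
    (σ : E n → E n) : Prop where
  f_memLp : MemLp f (conj p) (volume.restrict D.Ω)
  t_memLp : MemLp t (conj q) ((surface n).restrict D.Γt)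
  σ_continuousOn : ContinuousOn σ (closure D.Ω)
  isEquilibrium : IsEquilibrium D p q β f t σ

end DoubleWell

end

/-!
The equilibrium equation turns the load terms into `-∫ ⟨σ, ∇u⟩`, so that `P_n(u) = ∫ (W(∇u) - ⟨σ,
∇u⟩)` on `𝓤₀` (`energy_eq`), and everything is decided by the function `y ↦ W(y) - ⟨s, y⟩` on `ℝⁿ`
with `s = σ(x)`. If `z` solves the dual algebraic equation, then `z⁻¹ s` is a critical point of
this function, the value there is the integrand of `P_n^d`, and the exact expansion (`W_expansion`)
is `W(z⁻¹ s + k) - ⟨s, z⁻¹ s + k⟩ = value + z |k|² / 2 + ν / 2 (⟨z⁻¹ s, k⟩ + |k|² / 2)²`. A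
function that corresponds to `ζ` is differentiable with gradient `ζ⁻¹ σ`, hence its weak gradient
is this field (`SpaceU.grad_eq_of_isPathIntegral`).

* For `z > 0` the dual integrand at any `z` bounds `W(y) - ⟨s, y⟩` from below at any `y`
  (`dualDensity_le`), which gives both global statements.
* For `z < 0` the Hessian at `z⁻¹ s` is `z I + ν y ⊗ y` with `y = z⁻¹ s`, `ν |y|² = 2 (ν lam + z)`:
  it has the eigenvalue `z` across `y` and `3 z + 2 ν lam` along `y`. The second changes sign at
  the critical point `-2 ν lam / 3` of the cubic. Since `σ` is continuous on the compact closure of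
  `Ω`, so are the root functions, the eigenvalues stay uniformly away from `0`, and pointwise
  extremality holds in a uniform neighbourhood. The extremality of the dual energy comes from the
  factorization `dualDensity_sub`; the cases of infinite dual energy are split off by
  `dualEnergy_eq_bot_or` and `dualEnergy_eq_top_or`.

For the middle root in dimension `n ≥ 2`, the eigenvalue `z` across `y` is negative: in the unit
ball take `σ` constant and `u` affine, with `-2 ν lam / 3 < z < -ν lam / 2`. The second variation
at a test function `φ` is `∫ (z |∇φ|² + ν ⟨∇u, ∇φ⟩²)`; choosing the direction of `∇u` among two
coordinate directions so that it carries at most half of `∫ |∇φ|²`, this is at most `(2 z + ν lam)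
∫ |∇φ|² < 0`.

The counterexample lives in `𝓤₀`, whose traces, normal derivatives and equilibrium equation are
defined by Green's formula with Hausdorff measure on the sphere. So the divergence theorem in the
ball is needed (`integral_ball_divergence`). A field is split into `⟨F, x⟩ x`, integrated in polar
coordinates, and a field tangential on the sphere, whose divergence has integral zero by a cutoff
argument. This yields the surface measure of polar coordinates, which is identified with Hausdorff
measure by differentiation of measures along balls (`surface_restrict_sphere`): a small spherical
cap is squeezed between Lipschitz images of a flat disc, and the cone over it between flat cones,
with ratios that tend to `1`.
-/

namespace DoubleWell

/-! ### The cubic of the dual algebraic equation -/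

/-- The right-hand side of the dual algebraic equation, a cubic polynomial in `z`. -/
noncomputable def cubic (ν lam z : ℝ) : ℝ := 2 * z ^ 2 * (lam + z / ν)

lemma continuous_cubic (ν lam : ℝ) : Continuous (cubic ν lam) := by
  unfold cubic; fun_prop

section Roots

variable {ν lam : ℝ}

lemma cubic_sub (hν : 0 < ν) (x y : ℝ) :
    cubic ν lam y - cubic ν lam x =
      2 / ν * ((y - x) * (y ^ 2 + x * y + x ^ 2 + ν * lam * (x + y))) := by
  unfold cubic
  field_simp
  ring

lemma cubic_zero : cubic ν lam 0 = 0 := by simp [cubic]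

lemma cubic_neg (hν : 0 < ν) : cubic ν lam (-(ν * lam)) = 0 := by
  unfold cubic
  field_simp
  ring

lemma cubic_crit (hν : 0 < ν) :
    cubic ν lam (-(2 * ν * lam / 3)) = 8 * lam ^ 3 * ν ^ 2 / 27 := by
  unfold cubic
  field_simp
  ring

lemma cubic_strictMonoOn_Ici (hν : 0 < ν) (hlam : 0 < lam) :
    StrictMonoOn (cubic ν lam) (Ici 0) := by
  intro x hx y hy hxy
  rw [← sub_pos, cubic_sub hν]
  have hx : 0 ≤ x := hx
  have : 0 < y := hx.trans_lt hxy
  have := sub_pos.2 hxy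
  positivity

lemma cubic_strictAntiOn_Icc (hν : 0 < ν) (hlam : 0 < lam) :
    StrictAntiOn (cubic ν lam) (Icc (-(2 * ν * lam / 3)) 0) := by
  intro x hx y hy hxy
  have hs := cubic_sub (lam := lam) hν x y
  obtain ⟨hx1, hx2⟩ := hx
  obtain ⟨hy1, hy2⟩ := hy
  have h1 := sub_pos.2 hxy
  have h0 : 0 < ν * lam := by positivity
  have : y ^ 2 + x * y + x ^ 2 + ν * lam * (x + y) < 0 := by
    have hx3 : x < 0 := hxy.trans_le hy2
    nlinarith [mul_nonneg (neg_nonneg.2 hx2) (show (0:ℝ) ≤ x + 2 * ν * lam / 3 by linarith),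
      mul_nonneg (neg_nonneg.2 hy2) (show (0:ℝ) ≤ y + 2 * ν * lam / 3 by linarith),
      mul_pos (neg_pos.2 hx3) (show (0:ℝ) < y + 2 * ν * lam / 3 by linarith),
      mul_nonneg (neg_nonneg.2 hy2) (show (0:ℝ) ≤ x + 2 * ν * lam / 3 by linarith)]
  have h2 : (y - x) * (y ^ 2 + x * y + x ^ 2 + ν * lam * (x + y)) < 0 :=
    mul_neg_of_pos_of_neg h1 this
  have h3 : 2 / ν * ((y - x) * (y ^ 2 + x * y + x ^ 2 + ν * lam * (x + y))) < 0 :=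
    mul_neg_of_pos_of_neg (by positivity) h2
  linarith

lemma cubic_strictMonoOn_Iic (hν : 0 < ν) (hlam : 0 < lam) :
    StrictMonoOn (cubic ν lam) (Iic (-(2 * ν * lam / 3))) := by
  intro x hx y hy hxy
  rw [← sub_pos, cubic_sub hν]
  have hx : x ≤ -(2 * ν * lam / 3) := hx
  have hy : y ≤ -(2 * ν * lam / 3) := hy
  have h1 := sub_pos.2 hxy
  have h0 : 0 < ν * lam := by positivity
  have : 0 < y ^ 2 + x * y + x ^ 2 + ν * lam * (x + y) := by
    nlinarith [mul_nonneg (show (0:ℝ) ≤ -x by linarith)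
        (show (0:ℝ) ≤ -(2 * ν * lam / 3) - x by linarith),
      mul_nonneg (show (0:ℝ) ≤ -y by linarith) (show (0:ℝ) ≤ -(2 * ν * lam / 3) - y by linarith),
      mul_pos (show (0:ℝ) < -y by linarith) (show (0:ℝ) < -(2 * ν * lam / 3) - x by linarith),
      mul_nonneg (show (0:ℝ) ≤ -x by linarith) (show (0:ℝ) ≤ -(2 * ν * lam / 3) - y by linarith)]
  positivity

lemma cubic_le_of_nonpos (hν : 0 < ν) (hlam : 0 < lam) {z : ℝ} (hz : z ≤ 0) :
    cubic ν lam z ≤ 8 * lam ^ 3 * ν ^ 2 / 27 := by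
  rw [← cubic_crit hν]
  rcases le_total z (-(2 * ν * lam / 3)) with h | h
  · exact (cubic_strictMonoOn_Iic hν hlam).monotoneOn h self_mem_Iic h
  · refine (cubic_strictAntiOn_Icc hν hlam).antitoneOn ⟨le_rfl, ?_⟩ ⟨h, hz⟩ h
    exact h.trans hz

lemma exists_pos_root (hν : 0 < ν) (hlam : 0 < lam) {r : ℝ} (hr : 0 < r) :
    ∃ z, 0 < z ∧ cubic ν lam z = r := by
  -- at `M = 1 + r / (2 lam)` the cubic is at least `2 lam M ≥ r`
  set M : ℝ := 1 + r / (2 * lam) with hM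
  have hM1 : 1 ≤ M := by rw [hM]; linarith [show 0 < r / (2 * lam) by positivity]
  have hrM : r ≤ cubic ν lam M := by
    have h1 : r ≤ 2 * lam * M := by
      rw [hM, mul_add, mul_div_cancel₀ _ (by positivity)]; linarith
    have h2 : 2 * lam * M ≤ cubic ν lam M := by
      have h3 : 0 ≤ M / ν := by positivity
      unfold cubic
      nlinarith [mul_nonneg (sq_nonneg M) h3, mul_nonneg hlam.le (sub_nonneg.2 hM1)]
    exact h1.trans h2
  obtain ⟨z, hz, hzr⟩ := intermediate_value_Icc (by linarith : (0 : ℝ) ≤ M)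
    (continuous_cubic ν lam).continuousOn ⟨by rw [cubic_zero]; exact hr.le, hrM⟩
  refine ⟨z, lt_of_le_of_ne hz.1 ?_, hzr⟩
  rintro rfl
  rw [cubic_zero] at hzr
  exact hr.ne hzr

/-- Above the local maximum value of the cubic, the dual algebraic equation has one real root. -/
lemma exists_unique_root (hν : 0 < ν) (hlam : 0 < lam) {r : ℝ}
    (hr : 8 * lam ^ 3 * ν ^ 2 / 27 < r) :
    ∃ z, 0 < z ∧ ∀ w, r = cubic ν lam w ↔ w = z := by
  obtain ⟨z, hz, hzr⟩ := exists_pos_root hν hlam (lt_trans (by positivity) hr)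
  refine ⟨z, hz, fun w => ⟨fun hw => ?_, fun hw => by rw [hw, hzr]⟩⟩
  have hw0 : 0 < w := by
    by_contra! h
    linarith [cubic_le_of_nonpos hν hlam h]
  exact (cubic_strictMonoOn_Ici hν hlam).injOn hw0.le hz.le (by rw [hzr, hw])

/-- Below the local maximum value of the cubic, the dual algebraic equation has three real roots,
separated by the critical points of the cubic. -/
lemma exists_three_roots (hν : 0 < ν) (hlam : 0 < lam) {r : ℝ} (hr0 : 0 < r)
    (hr : r < 8 * lam ^ 3 * ν ^ 2 / 27) :
    ∃ z₁ z₂ z₃, (0 < z₁ ∧ z₂ < 0 ∧ -(2 * ν * lam / 3) < z₂ ∧ z₃ < -(2 * ν * lam / 3) ∧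
      -(ν * lam) < z₃) ∧ ∀ w, r = cubic ν lam w ↔ w = z₁ ∨ w = z₂ ∨ w = z₃ := by
  have hνl : 0 < ν * lam := by positivity
  have hc : Continuous (cubic ν lam) := continuous_cubic ν lam
  obtain ⟨z₁, hz₁, hzr₁⟩ := exists_pos_root hν hlam hr0
  obtain ⟨z₂, hz₂, hzr₂⟩ := intermediate_value_Ioo' (by linarith : -(2 * ν * lam / 3) ≤ 0)
    hc.continuousOn (show r ∈ Ioo _ _ by rw [cubic_zero, cubic_crit hν]; exact ⟨hr0, hr⟩)
  obtain ⟨z₃, hz₃, hzr₃⟩ := intermediate_value_Ioo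
    (by linarith : -(ν * lam) ≤ -(2 * ν * lam / 3))
    hc.continuousOn (show r ∈ Ioo _ _ by rw [cubic_neg hν, cubic_crit hν]; exact ⟨hr0, hr⟩)
  refine ⟨z₁, z₂, z₃, ⟨hz₁, hz₂.2, hz₂.1, hz₃.2, hz₃.1⟩, fun w => ⟨fun hw => ?_, ?_⟩⟩
  · rcases le_total 0 w with h | h
    · exact Or.inl ((cubic_strictMonoOn_Ici hν hlam).injOn h hz₁.le (by rw [hzr₁, hw]))
    rcases le_total w (-(2 * ν * lam / 3)) with h' | h'
    · exact Or.inr (Or.inr ((cubic_strictMonoOn_Iic hν hlam).injOn h' hz₃.2.le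
        (by rw [hzr₃, hw])))
    · exact Or.inr (Or.inl ((cubic_strictAntiOn_Icc hν hlam).injOn ⟨h', h⟩ (Ioo_subset_Icc_self hz₂)
        (by rw [hzr₂, hw])))
  · rintro (rfl | rfl | rfl) <;> simp [*]

end Roots

/-- A function whose composition with a function strictly monotone on an open set `I` containing its
values is continuous is itself continuous. -/
lemma continuousOn_of_strictMonoOn_comp {X : Type*} [TopologicalSpace X] {s : Set X} {I : Set ℝ}
    (hI : IsOpen I) {k : ℝ → ℝ} (hk : StrictMonoOn k I) {z : X → ℝ} (hz : ∀ x ∈ s, z x ∈ I)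
    (hc : ContinuousOn (fun x => k (z x)) s) : ContinuousOn z s := by
  intro x hx
  have hcx := hc x hx
  obtain ⟨ε, hε, hball⟩ := Metric.isOpen_iff.1 hI (z x) (hz x hx)
  rw [ContinuousWithinAt, Metric.tendsto_nhds]
  intro δ hδ
  set η := min (ε / 2) (δ / 2) with hη
  have hη0 : 0 < η := by positivity
  have hηε : η < ε := (min_le_left _ _).trans_lt (by linarith)
  have hηδ : η < δ := (min_le_right _ _).trans_lt (by linarith)
  have ha : z x - η ∈ I := hball (by simp [abs_of_pos hη0, hηε])
  have hb : z x + η ∈ I := hball (by simp [abs_of_pos hη0, hηε])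
  have h1 : k (z x - η) < k (z x) := hk ha (hz x hx) (by linarith)
  have h2 : k (z x) < k (z x + η) := hk (hz x hx) hb (by linarith)
  filter_upwards [hcx.eventually (lt_mem_nhds h1), hcx.eventually (gt_mem_nhds h2),
    self_mem_nhdsWithin] with y hy1 hy2 hys
  have h3 := (hk.lt_iff_lt ha (hz y hys)).1 hy1
  have h4 := (hk.lt_iff_lt (hz y hys) hb).1 hy2
  rw [Real.dist_eq, abs_lt]
  constructor <;> linarith

lemma continuousOn_of_strictAntiOn_comp {X : Type*} [TopologicalSpace X] {s : Set X} {I : Set ℝ}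
    (hI : IsOpen I) {k : ℝ → ℝ} (hk : StrictAntiOn k I) {z : X → ℝ} (hz : ∀ x ∈ s, z x ∈ I)
    (hc : ContinuousOn (fun x => k (z x)) s) : ContinuousOn z s :=
  continuousOn_of_strictMonoOn_comp hI hk.neg hz hc.neg

/-! ### The integrands of the primal and the dual energy -/

/-- The integrand of the pure complementary energy where `σ` has value `s` and `ζ` has
value `z`. -/
noncomputable def dualDensity {n : ℕ} (ν lam : ℝ) (s : E n) (z : ℝ) : ℝ :=
  -(‖s‖ ^ 2 / (2 * z) + (lam * z + z ^ 2 / (2 * ν)))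

section Pointwise

variable {n : ℕ} {ν lam : ℝ} {s : E n} {z : ℝ}

/-- Weak duality: the Fenchel inequality for the square in `W`, and a completed square. -/
lemma dualDensity_le (hν : 0 < ν) (hz : 0 < z) (y : E n) :
    dualDensity ν lam s z ≤ W ν lam y - ⟪s, y⟫ := by
  have h1 : 0 ≤ ‖s - z • y‖ ^ 2 := by positivity
  rw [norm_sub_sq_real, norm_smul, mul_pow, inner_smul_right, Real.norm_eq_abs, sq_abs] at h1
  have h2 : 0 ≤ (ν * (‖y‖ ^ 2 / 2 - lam) - z) ^ 2 := sq_nonneg _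
  have key : W ν lam y - ⟪s, y⟫ - dualDensity ν lam s z =
      (ν * (‖y‖ ^ 2 / 2 - lam) - z) ^ 2 / (2 * ν) +
        (‖s‖ ^ 2 - 2 * (z * ⟪s, y⟫) + z ^ 2 * ‖y‖ ^ 2) / (2 * z) := by
    unfold W dualDensity
    field_simp
    ring
  rw [← sub_nonneg, key]
  positivity

lemma norm_sq_inv_smul (hν : 0 < ν) (hz : z ≠ 0) (h : DAE ν lam s z) :
    ν * ‖z⁻¹ • s‖ ^ 2 = 2 * (ν * lam + z) := by
  unfold DAE at h
  rw [norm_smul, mul_pow, norm_inv, inv_pow, Real.norm_eq_abs, sq_abs, h]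
  field_simp

/-- Second-order expansion of `y ↦ W(y) - ⟨s, y⟩` at its critical point `z⁻¹ s`. -/
lemma W_expansion (hν : 0 < ν) (hz : z ≠ 0) (h : DAE ν lam s z) (k : E n) :
    W ν lam (z⁻¹ • s + k) - ⟪s, z⁻¹ • s + k⟫ =
      dualDensity ν lam s z + (z * ‖k‖ ^ 2 / 2 + ν / 2 * (⟪z⁻¹ • s, k⟫ + ‖k‖ ^ 2 / 2) ^ 2) := by
  have h1 := norm_sq_inv_smul hν hz h
  have hs : ⟪s, k⟫ = z * ⟪z⁻¹ • s, k⟫ := by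
    rw [inner_smul_left]; simp [hz]
  have hss : ⟪s, z⁻¹ • s⟫ = z * ‖z⁻¹ • s‖ ^ 2 := by
    rw [← real_inner_self_eq_norm_sq, inner_smul_left]
    simp [hz]
  have hs2 : ‖s‖ ^ 2 = z ^ 2 * ‖z⁻¹ • s‖ ^ 2 := by
    rw [norm_smul, mul_pow, norm_inv, inv_pow, Real.norm_eq_abs, sq_abs]
    field_simp
  unfold W dualDensity
  rw [inner_add_right, norm_add_sq_real, hs, hss, hs2]
  set a := ‖z⁻¹ • s‖ ^ 2
  set b := ⟪z⁻¹ • s, k⟫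
  have ha : a = 2 * (ν * lam + z) / ν := by field_simp; linarith
  rw [ha]
  field_simp
  ring

lemma W_critical (hν : 0 < ν) (hz : z ≠ 0) (h : DAE ν lam s z) :
    W ν lam (z⁻¹ • s) - ⟪s, z⁻¹ • s⟫ = dualDensity ν lam s z := by
  simpa using W_expansion hν hz h 0

/-- The increment of the dual density from `w` to a root `z` of the dual algebraic equation; for
`w < 0` its sign is opposite to that of `2 z + w + 2 ν lam`. -/
lemma dualDensity_sub {w : ℝ} (hν : 0 < ν) (hw : w ≠ 0) (h : DAE ν lam s z) :
    dualDensity ν lam s z - dualDensity ν lam s w =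
      (z - w) ^ 2 / (2 * w) * (2 * lam + (2 * z + w) / ν) := by
  unfold DAE at h
  unfold dualDensity
  rw [h]
  field_simp
  ring

end Pointwise

/-! ### Local extrema of the integrand -/

section LocalExtrema

variable {n : ℕ} {ν lam : ℝ} {s : E n} {z : ℝ}

/-- If `3 z + 2 ν lam < 0`, then the Hessian `z I + ν y ⊗ y` of `W` at `y = z⁻¹ s` is negative
definite; the size of the neighbourhood depends only on the gap `ε`. -/
lemma W_sub_inner_le_near (hν : 0 < ν) (hlam : 0 < lam) (h : DAE ν lam s z) {ε δ : ℝ}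
    (hz : 3 * z + 2 * ν * lam ≤ -ε) (hε : 0 ≤ ε) (hδ : δ ≤ 1) (hδε : ν * (√(2 * lam) + 1) * δ ≤ ε)
    {k : E n} (hk : ‖k‖ ≤ δ) :
    W ν lam (z⁻¹ • s + k) - ⟪s, z⁻¹ • s + k⟫ ≤ dualDensity ν lam s z := by
  have hνl : 0 < ν * lam := by positivity
  have hz0 : z < 0 := by nlinarith
  rw [W_expansion hν hz0.ne h]
  have h1 := norm_sq_inv_smul hν hz0.ne h
  set a := ‖z⁻¹ • s‖
  set r := ‖k‖
  have ha : a ≤ √(2 * lam) := by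
    apply Real.le_sqrt_of_sq_le
    nlinarith
  have ha0 : 0 ≤ a := norm_nonneg _
  have hr0 : 0 ≤ r := norm_nonneg _
  have hb : |⟪z⁻¹ • s, k⟫| ≤ a * r := abs_real_inner_le_norm _ _
  have h2 : (⟪z⁻¹ • s, k⟫ + r ^ 2 / 2) ^ 2 ≤ (a * r + r ^ 2 / 2) ^ 2 := by
    apply sq_le_sq'
    · nlinarith [neg_abs_le ⟪z⁻¹ • s, k⟫, sq_nonneg r]
    · linarith [le_abs_self ⟪z⁻¹ • s, k⟫]
  have h3 : ν * (a * r + r ^ 2 / 4) ≤ ε := by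
    have : a * r + r ^ 2 / 4 ≤ (√(2 * lam) + 1) * δ := by
      have := mul_le_mul ha hk hr0 (Real.sqrt_nonneg _)
      nlinarith
    nlinarith
  have h4 : z + ν * (a + r / 2) ^ 2 ≤ 0 := by nlinarith
  have h5 : (a * r + r ^ 2 / 2) ^ 2 = r ^ 2 * (a + r / 2) ^ 2 := by ring
  nlinarith [mul_nonneg (sq_nonneg r) (neg_nonneg.2 h4), mul_le_mul_of_nonneg_left h2 hν.le]

/-- In dimension one, where `⟨y, k⟩² = |y|² |k|²`, the Hessian of `W` at `y = z⁻¹ s` is the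
number `3 z + 2 ν lam`. -/
lemma le_W_sub_inner_near (hn : n = 1) (hν : 0 < ν) (h : DAE ν lam s z)
    (hz0 : z < 0) {ε δ : ℝ} (hz : ε ≤ 3 * z + 2 * ν * lam) (hδε : ν * √(2 * lam) * δ ≤ ε)
    {k : E n} (hk : ‖k‖ ≤ δ) :
    dualDensity ν lam s z ≤ W ν lam (z⁻¹ • s + k) - ⟪s, z⁻¹ • s + k⟫ := by
  rw [W_expansion hν hz0.ne h]
  have h1 := norm_sq_inv_smul hν hz0.ne h
  have hb : ⟪z⁻¹ • s, k⟫ ^ 2 = ‖z⁻¹ • s‖ ^ 2 * ‖k‖ ^ 2 := by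
    subst hn
    generalize z⁻¹ • s = y
    simp only [EuclideanSpace.norm_sq_eq, PiLp.inner_apply, Fin.sum_univ_one]
    simp [mul_pow, mul_comm]
  have hb' : |⟪z⁻¹ • s, k⟫| ≤ ‖z⁻¹ • s‖ * ‖k‖ := abs_real_inner_le_norm _ _
  set a := ‖z⁻¹ • s‖
  set r := ‖k‖
  set b := ⟪z⁻¹ • s, k⟫
  have ha : a ≤ √(2 * lam) := by
    apply Real.le_sqrt_of_sq_le
    nlinarith
  have ha0 : 0 ≤ a := norm_nonneg _
  have hr0 : 0 ≤ r := norm_nonneg _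
  have h3 : ν * (a * r) ≤ ε := by
    have := mul_le_mul ha hk hr0 (Real.sqrt_nonneg _)
    nlinarith
  have h2 : r ^ 2 * (a ^ 2 - a * r) ≤ (b + r ^ 2 / 2) ^ 2 := by
    have : -(a * r) ≤ b := (neg_le_neg hb').trans (neg_abs_le b)
    nlinarith [mul_le_mul_of_nonneg_right this (sq_nonneg r), sq_nonneg (r ^ 2)]
  have h4 : 0 ≤ z + ν * (a ^ 2 - a * r) := by nlinarith
  nlinarith [mul_nonneg (sq_nonneg r) h4, mul_le_mul_of_nonneg_left h2 hν.le]

end LocalExtrema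

/-! ### Gradients of path integrals -/

section WeakGradient

variable {n : ℕ} {Ω : Set (E n)}

/-- Near `x` the path may be taken to be a segment, and the integral along segments has the
integrand as its derivative at the fixed end. -/
lemma hasFDerivAt_of_isPathIntegral (hΩ : IsOpen Ω) {σ : E n → E n} {ζ u : E n → ℝ}
    (hc : ContinuousOn (fun y => (ζ y)⁻¹ • σ y) Ω) (hu : IsPathIntegral Ω σ ζ u) {x : E n}
    (hx : x ∈ Ω) : HasFDerivAt u (innerSL ℝ ((ζ x)⁻¹ • σ x)) x := by
  set F : E n → E n →L[ℝ] ℝ := fun y => innerSL ℝ ((ζ y)⁻¹ • σ y)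
  have hFc : ∀ y ∈ Ω, ContinuousAt F y := fun y hy =>
    (innerSL ℝ).continuous.continuousAt.comp (hc.continuousAt (hΩ.mem_nhds hy))
  have h1 : HasFDerivAt (fun y => curveIntegral F (Path.segment x y)) (F x) x :=
    HasFDerivAt.curveIntegral_segment_source'
      (Filter.eventually_of_mem (hΩ.mem_nhds hx) hFc)
  have h2 := h1.add_const (u x)
  refine h2.congr_of_eventuallyEq ?_
  obtain ⟨r, hr, hball⟩ := Metric.isOpen_iff.1 hΩ x hx
  filter_upwards [Metric.ball_mem_nhds x hr] with y hy
  refine hu x y (Path.segment x y) ?_ fun s => ?_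
  · refine ContDiffOn.congr (f := fun t => AffineMap.lineMap x y t) ?_
      (Path.eqOn_extend_segment x y)
    simp only [AffineMap.lineMap_apply_module']
    fun_prop
  · apply hball
    apply (convex_ball x r).segment_subset (Metric.mem_ball_self hr) hy
    simpa using lineMap_mem_segment ℝ x y s.2

lemma integrable_mul_of_tsupport_subset {f φ : E n → ℝ} (hφ : Continuous φ)
    (hφc : HasCompactSupport φ) (hf : IntegrableOn f (tsupport φ)) :
    Integrable (fun x => f x * φ x) := by
  rw [← integrableOn_iff_integrable_of_support_subset (s := tsupport φ)]
  · exact hf.mul_continuousOn hφ.continuousOn hφc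
  · intro x hx
    apply subset_tsupport
    intro h
    simp [h] at hx

lemma continuous_partialD {φ : E n → ℝ} (hφ : ContDiff ℝ ∞ φ) (i : Fin n) :
    Continuous (partialD φ i) :=
  (hφ.continuous_fderiv (by simp)).clm_apply continuous_const

lemma tsupport_partialD_subset (φ : E n → ℝ) (i : Fin n) :
    tsupport (partialD φ i) ⊆ tsupport φ :=
  tsupport_fderiv_apply_subset ℝ _

/-- A classical continuous gradient is a weak gradient. -/
lemma isWeakGradient_of_hasFDerivAt {u : E n → ℝ} {F : E n → E n}
    (hF : ContinuousOn F Ω) (hu : ∀ x ∈ Ω, HasFDerivAt u (innerSL ℝ (F x)) x) :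
    IsWeakGradient Ω u F := by
  intro φ hφ hφc hφΩ i
  have huc : ContinuousOn u Ω := fun x hx => (hu x hx).continuousAt.continuousWithinAt
  have hF' : ∀ x ∈ Ω, fderiv ℝ u x (EuclideanSpace.single i 1) = F x i := by
    intro x hx
    rw [(hu x hx).fderiv, innerSL_apply_apply, EuclideanSpace.inner_single_right]
    simp
  have hφ0 : ∀ x, x ∉ Ω → φ x = 0 := fun x hx => by
    by_contra h
    exact hx (hφΩ (subset_tsupport φ h))
  have hdφ0 : ∀ x, x ∉ Ω → partialD φ i x = 0 := fun x hx => by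
    by_contra h
    exact hx (hφΩ (tsupport_partialD_subset φ i (subset_tsupport _ h)))
  have key := integral_mul_fderiv_eq_neg_fderiv_mul_of_integrable (f := u) (g := φ)
    (v := EuclideanSpace.single i (1 : ℝ)) (μ := volume) ?_ ?_ ?_ ?_ ?_
  · rw [setIntegral_eq_integral_of_forall_compl_eq_zero (fun x hx => by simp [hdφ0 x hx]),
      setIntegral_eq_integral_of_forall_compl_eq_zero (fun x hx => by simp [hφ0 x hx])]
    refine key.trans ?_
    congr 1
    refine integral_congr_ae (.of_forall fun x => ?_)
    by_cases hx : x ∈ Ω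
    · simp [hF' x hx]
    · simp [hφ0 x hx]
  · apply integrable_mul_of_tsupport_subset hφ.continuous hφc
    have h1 : ContinuousOn (fun x => F x i) (tsupport φ) :=
      (EuclideanSpace.proj (𝕜 := ℝ) i).continuous.comp_continuousOn (hF.mono hφΩ)
    exact (h1.integrableOn_compact hφc).congr_fun (fun x hx => (hF' x (hφΩ hx)).symm)
      (isClosed_tsupport φ).measurableSet
  · apply integrable_mul_of_tsupport_subset (continuous_partialD hφ i)
    · exact hφc.mono' ((subset_tsupport _).trans (tsupport_partialD_subset φ i))
    · exact ((huc.mono hφΩ).integrableOn_compact hφc).mono_set (tsupport_partialD_subset φ i)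
  · exact integrable_mul_of_tsupport_subset hφ.continuous hφc
      ((huc.mono hφΩ).integrableOn_compact hφc)
  · exact fun x hx => (hu x (hφΩ hx)).differentiableAt
  · exact fun x _ => (hφ.differentiable (by simp)).differentiableAt

/-- Weak gradients are unique. -/
lemma IsWeakGradient.ae_eq (hΩ : IsOpen Ω) {u : E n → ℝ} {F G : E n → E n}
    (hF : IsWeakGradient Ω u F) (hG : IsWeakGradient Ω u G)
    (hFi : LocallyIntegrableOn F Ω) (hGi : LocallyIntegrableOn G Ω) :
    ∀ᵐ x ∂(volume.restrict Ω), F x = G x := by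
  have hi : ∀ i, ∀ᵐ x, x ∈ Ω → F x i - G x i = 0 := by
    intro i
    have hproj : ∀ {H : E n → E n}, LocallyIntegrableOn H Ω →
        LocallyIntegrableOn (fun x => H x i) Ω := fun {H} hH x hx => by
      obtain ⟨t, ht, hti⟩ := hH x hx
      exact ⟨t, ht, (EuclideanSpace.proj (𝕜 := ℝ) i).integrable_comp hti⟩
    apply hΩ.ae_eq_zero_of_integral_contDiff_smul_eq_zero ((hproj hFi).sub (hproj hGi))
    intro φ hφ hφc hφΩ
    have hφ0 : ∀ x, x ∉ Ω → φ x = 0 := fun x hx => by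
      by_contra h
      exact hx (hφΩ (subset_tsupport φ h))
    have hint : ∀ {H : E n → E n}, LocallyIntegrableOn H Ω →
        Integrable (fun x => H x i * φ x) := fun {H} hH =>
      integrable_mul_of_tsupport_subset hφ.continuous hφc
        ((hproj hH).integrableOn_compact_subset hφΩ hφc)
    have h1 := hF φ hφ hφc hφΩ i
    rw [hG φ hφ hφc hφΩ i, neg_inj,
      setIntegral_eq_integral_of_forall_compl_eq_zero (fun x hx => by simp [hφ0 x hx]),
      setIntegral_eq_integral_of_forall_compl_eq_zero (fun x hx => by simp [hφ0 x hx])] at h1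
    rw [← sub_eq_zero.2 h1.symm, ← integral_sub (hint hFi) (hint hGi)]
    refine integral_congr_ae (.of_forall fun x => ?_)
    simp only [smul_eq_mul, Pi.sub_apply]
    ring
  rw [ae_restrict_iff' hΩ.measurableSet]
  filter_upwards [ae_all_iff.2 hi] with x hx hxΩ
  ext i
  exact sub_eq_zero.1 (hx i hxΩ)

end WeakGradient

/-! ### The energy as one integral -/

section Energy

variable {n : ℕ} {D : BoundaryDomain n} {p q β : ℝ≥0∞} {f t : E n → ℝ} {σ : E n → E n}
  {ν lam : ℝ}

lemma BoundaryDomain.isCompact_closure (D : BoundaryDomain n) : IsCompact (closure D.Ω) :=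
  D.isBounded.isCompact_closure

instance BoundaryDomain.isFiniteMeasure (D : BoundaryDomain n) :
    IsFiniteMeasure (volume.restrict D.Ω) :=
  ⟨by simpa using D.isBounded.measure_lt_top⟩

lemma aestronglyMeasurable_of_continuousOn_closure (D : BoundaryDomain n) {F : Type*}
    [NormedAddCommGroup F] {g : E n → F}
    (hg : ContinuousOn g (closure D.Ω)) : AEStronglyMeasurable g (volume.restrict D.Ω) :=
  (hg.mono subset_closure).aestronglyMeasurable D.isOpen.measurableSet

lemma exists_bound_of_continuousOn_closure (D : BoundaryDomain n) {F : Type*}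
    [NormedAddCommGroup F] {g : E n → F} (hg : ContinuousOn g (closure D.Ω)) :
    ∃ C, ∀ᵐ x ∂(volume.restrict D.Ω), ‖g x‖ ≤ C := by
  obtain ⟨C, hC⟩ := D.isCompact_closure.exists_bound_of_continuousOn hg
  exact ⟨C, (ae_restrict_iff' D.isOpen.measurableSet).2
    (.of_forall fun x hx => hC x (subset_closure hx))⟩

lemma memLp_of_continuousOn_closure (D : BoundaryDomain n) {F : Type*}
    [NormedAddCommGroup F] {g : E n → F} (hg : ContinuousOn g (closure D.Ω)) (r : ℝ≥0∞) :
    MemLp g r (volume.restrict D.Ω) := by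
  obtain ⟨C, hC⟩ := exists_bound_of_continuousOn_closure D hg
  exact .of_bound (aestronglyMeasurable_of_continuousOn_closure D hg) C hC

/-- The gradient of a solution corresponding to `ζ` is `ζ⁻¹ σ`. -/
lemma SpaceU.grad_eq_of_isPathIntegral (u : SpaceU D p) {ζ : E n → ℝ}
    (hc : ContinuousOn (fun y => (ζ y)⁻¹ • σ y) (closure D.Ω))
    (hu : IsPathIntegral D.Ω σ ζ u.toFun) :
    ∀ᵐ x ∂(volume.restrict D.Ω), u.grad x = (ζ x)⁻¹ • σ x := by
  have hcΩ := hc.mono subset_closure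
  refine IsWeakGradient.ae_eq D.isOpen u.isWeakGradient
    (isWeakGradient_of_hasFDerivAt hcΩ
      fun x hx => hasFDerivAt_of_isPathIntegral D.isOpen hcΩ hu hx) ?_ ?_
  · exact IntegrableOn.locallyIntegrableOn (u.grad_memLp.integrable (by norm_num))
  · exact IntegrableOn.locallyIntegrableOn
      ((memLp_of_continuousOn_closure D hc 1).integrable le_rfl)

lemma integrable_W (u : SpaceU D p) :
    Integrable (fun x => W ν lam (u.grad x)) (volume.restrict D.Ω) := by
  have h4 : Integrable (fun x => ‖u.grad x‖ ^ 4) (volume.restrict D.Ω) := by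
    simpa using u.grad_memLp.integrable_norm_pow (p := 4) (by norm_num)
  have h2 : Integrable (fun x => ‖u.grad x‖ ^ 2) (volume.restrict D.Ω) := by
    have : MemLp u.grad 2 (volume.restrict D.Ω) := u.grad_memLp.mono_exponent (by norm_num)
    simpa using this.integrable_norm_pow (p := 2) (by norm_num)
  have := ((h4.const_mul (ν / 8)).sub (h2.const_mul (ν * lam / 2))).add
    (integrable_const (ν / 2 * lam ^ 2))
  refine this.congr (.of_forall fun x => ?_)
  simp only [W, Pi.add_apply, Pi.sub_apply]
  ring

lemma integrable_inner_grad (hσ : ContinuousOn σ (closure D.Ω)) (u : SpaceU D p) :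
    Integrable (fun x => ⟪σ x, u.grad x⟫) (volume.restrict D.Ω) := by
  have hu : Integrable u.grad (volume.restrict D.Ω) := u.grad_memLp.integrable (by norm_num)
  have hσm := aestronglyMeasurable_of_continuousOn_closure D hσ
  obtain ⟨C, hC⟩ := exists_bound_of_continuousOn_closure D hσ
  refine (hu.norm.const_mul C).mono' (hσm.inner hu.aestronglyMeasurable) ?_
  filter_upwards [hC] with x hx
  exact (norm_inner_le_norm _ _).trans (by gcongr)

/-- The energy as one integral, the load terms being replaced with the help of the equilibrium
equation. -/
lemma energy_eq (h : IsData D p q β f t σ) (u : SpaceU0 D p q β) :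
    energy ν lam f t u = ∫ x in D.Ω, (W ν lam (u.grad x) - ⟪σ x, u.grad x⟫) := by
  rw [integral_sub (integrable_W _) (integrable_inner_grad h.σ_continuousOn _),
    h.isEquilibrium u, energy]
  ring

lemma integrable_energy_density (hσ : ContinuousOn σ (closure D.Ω)) (u : SpaceU D p) :
    Integrable (fun x => W ν lam (u.grad x) - ⟪σ x, u.grad x⟫) (volume.restrict D.Ω) :=
  (integrable_W _).sub (integrable_inner_grad hσ _)

end Energy

/-! ### The dual energy -/

section DualEnergy

variable {n : ℕ} {D : BoundaryDomain n} {σ : E n → E n} {ζ : E n → ℝ} {ν lam : ℝ}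

lemma integrable_quadratic (hζ : MemLp ζ 2 (volume.restrict D.Ω)) :
    Integrable (fun x => lam * ζ x + ζ x ^ 2 / (2 * ν)) (volume.restrict D.Ω) :=
  ((hζ.integrable (by norm_num)).const_mul lam).add (hζ.integrable_sq.div_const (2 * ν))

lemma aestronglyMeasurable_quotient (hσ : AEStronglyMeasurable σ (volume.restrict D.Ω))
    (hζ : AEStronglyMeasurable ζ (volume.restrict D.Ω)) :
    AEStronglyMeasurable (fun x => ‖σ x‖ ^ 2 / (2 * ζ x)) (volume.restrict D.Ω) :=
  ((hσ.norm.aemeasurable.pow_const 2).div (hζ.aemeasurable.const_mul 2)).aestronglyMeasurable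

lemma integral_dualDensity (hζ : MemLp ζ 2 (volume.restrict D.Ω))
    (hi : Integrable (fun x => ‖σ x‖ ^ 2 / (2 * ζ x)) (volume.restrict D.Ω)) :
    ∫ x in D.Ω, dualDensity ν lam (σ x) (ζ x) =
      -(∫ x in D.Ω, ‖σ x‖ ^ 2 / (2 * ζ x)) - ∫ x in D.Ω, (lam * ζ x + ζ x ^ 2 / (2 * ν)) := by
  simp only [dualDensity]
  rw [integral_neg, integral_add hi (integrable_quadratic hζ)]
  ring

lemma integrable_dualDensity (hζ : MemLp ζ 2 (volume.restrict D.Ω))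
    (hi : Integrable (fun x => ‖σ x‖ ^ 2 / (2 * ζ x)) (volume.restrict D.Ω)) :
    Integrable (fun x => dualDensity ν lam (σ x) (ζ x)) (volume.restrict D.Ω) :=
  (hi.add (integrable_quadratic hζ)).neg

lemma ofReal_div_ofReal {a z : ℝ} (hz : 0 < z) :
    ENNReal.ofReal (a / 2) / ENNReal.ofReal z = ENNReal.ofReal (a / (2 * z)) := by
  rw [← ENNReal.ofReal_div_of_pos hz, div_div]

lemma lintegral_pos_part_of_pos (h : ∀ᵐ x ∂(volume.restrict D.Ω), 0 < ζ x) :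
    (∫⁻ x in D.Ω, (if 0 ≤ ζ x then ENNReal.ofReal (‖σ x‖ ^ 2 / 2) / ENNReal.ofReal (ζ x) else 0)) =
      ∫⁻ x in D.Ω, ENNReal.ofReal (‖σ x‖ ^ 2 / (2 * ζ x)) := by
  refine lintegral_congr_ae ?_
  filter_upwards [h] with x hx
  rw [if_pos hx.le, ofReal_div_ofReal hx]

lemma lintegral_neg_part_of_neg (h : ∀ᵐ x ∂(volume.restrict D.Ω), ζ x < 0) :
    (∫⁻ x in D.Ω, (if ζ x < 0 then ENNReal.ofReal (‖σ x‖ ^ 2 / 2) / ENNReal.ofReal (-ζ x) else 0)) =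
      ∫⁻ x in D.Ω, ENNReal.ofReal (-(‖σ x‖ ^ 2 / (2 * ζ x))) := by
  refine lintegral_congr_ae ?_
  filter_upwards [h] with x hx
  rw [if_pos hx, ofReal_div_ofReal (neg_pos.2 hx), mul_neg, div_neg]

lemma lintegral_pos_part_of_neg (h : ∀ᵐ x ∂(volume.restrict D.Ω), ζ x < 0) :
    (∫⁻ x in D.Ω, (if 0 ≤ ζ x then ENNReal.ofReal (‖σ x‖ ^ 2 / 2) / ENNReal.ofReal (ζ x) else 0)) =
      0 := by
  refine (lintegral_congr_ae ?_).trans lintegral_zero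
  filter_upwards [h] with x hx
  rw [if_neg hx.not_ge]

lemma lintegral_neg_part_of_nonneg (h : ∀ᵐ x ∂(volume.restrict D.Ω), 0 ≤ ζ x) :
    (∫⁻ x in D.Ω, (if ζ x < 0 then ENNReal.ofReal (‖σ x‖ ^ 2 / 2) / ENNReal.ofReal (-ζ x) else 0)) =
      0 := by
  refine (lintegral_congr_ae ?_).trans lintegral_zero
  filter_upwards [h] with x hx
  rw [if_neg hx.not_gt]

lemma dualEnergy_of_pos (hζ : MemLp ζ 2 (volume.restrict D.Ω))
    (h : ∀ᵐ x ∂(volume.restrict D.Ω), 0 < ζ x)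
    (hi : Integrable (fun x => ‖σ x‖ ^ 2 / (2 * ζ x)) (volume.restrict D.Ω)) :
    dualEnergy D ν lam σ ζ = ((∫ x in D.Ω, dualDensity ν lam (σ x) (ζ x) : ℝ) : EReal) := by
  have h0 : 0 ≤ᵐ[volume.restrict D.Ω] fun x => ‖σ x‖ ^ 2 / (2 * ζ x) := by
    filter_upwards [h] with x hx
    simp only [Pi.zero_apply]
    positivity
  rw [dualEnergy, lintegral_pos_part_of_pos h,
    lintegral_neg_part_of_nonneg (h.mono fun x hx => hx.le),
    ← ofReal_integral_eq_lintegral_ofReal hi h0, EReal.coe_ennreal_ofReal,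
    max_eq_left (integral_nonneg_of_ae h0), integral_dualDensity hζ hi]
  simp only [EReal.coe_ennreal_zero, zero_sub]
  norm_cast

lemma dualEnergy_of_neg (hζ : MemLp ζ 2 (volume.restrict D.Ω))
    (h : ∀ᵐ x ∂(volume.restrict D.Ω), ζ x < 0)
    (hi : Integrable (fun x => ‖σ x‖ ^ 2 / (2 * ζ x)) (volume.restrict D.Ω)) :
    dualEnergy D ν lam σ ζ = ((∫ x in D.Ω, dualDensity ν lam (σ x) (ζ x) : ℝ) : EReal) := by
  have h0 : 0 ≤ᵐ[volume.restrict D.Ω] fun x => -(‖σ x‖ ^ 2 / (2 * ζ x)) := by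
    filter_upwards [h] with x hx
    simp only [Pi.zero_apply]
    rw [← div_neg]
    have : 0 < -(2 * ζ x) := by linarith
    positivity
  rw [dualEnergy, lintegral_pos_part_of_neg h, lintegral_neg_part_of_neg h,
    ← ofReal_integral_eq_lintegral_ofReal (f := fun x => -(‖σ x‖ ^ 2 / (2 * ζ x))) hi.neg h0,
    EReal.coe_ennreal_ofReal,
    max_eq_left (integral_nonneg_of_ae h0), integral_dualDensity hζ hi, integral_neg]
  simp only [EReal.coe_ennreal_zero, sub_zero]
  norm_cast

/-- For `ζ ≥ 0` the dual energy is `-∞`, unless `ζ > 0` and `|σ|² / ζ` is integrable. -/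
lemma dualEnergy_eq_bot_or (hσ : AEStronglyMeasurable σ (volume.restrict D.Ω))
    (hσ0 : ∀ᵐ x ∂(volume.restrict D.Ω), σ x ≠ 0) (hζ : MemLp ζ 2 (volume.restrict D.Ω))
    (h : ∀ᵐ x ∂(volume.restrict D.Ω), 0 ≤ ζ x) :
    dualEnergy D ν lam σ ζ = ⊥ ∨ (∀ᵐ x ∂(volume.restrict D.Ω), 0 < ζ x) ∧
      Integrable (fun x => ‖σ x‖ ^ 2 / (2 * ζ x)) (volume.restrict D.Ω) := by
  by_cases htop : (∫⁻ x in D.Ω,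
      (if 0 ≤ ζ x then ENNReal.ofReal (‖σ x‖ ^ 2 / 2) / ENNReal.ofReal (ζ x) else 0)) = ⊤
  · left
    rw [dualEnergy, lintegral_neg_part_of_nonneg h, htop]
    simp
  · right
    have hm : AEMeasurable (fun x => if 0 ≤ ζ x then
        ENNReal.ofReal (‖σ x‖ ^ 2 / 2) / ENNReal.ofReal (ζ x) else 0) (volume.restrict D.Ω) := by
      have h1 : AEMeasurable (fun x => ENNReal.ofReal (‖σ x‖ ^ 2 / 2) / ENNReal.ofReal (ζ x))
          (volume.restrict D.Ω) :=
        (((hσ.norm.aemeasurable.pow_const 2).div_const 2).ennreal_ofReal).div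
          hζ.1.aemeasurable.ennreal_ofReal
      refine h1.congr ?_
      filter_upwards [h] with x hx
      rw [if_pos hx]
    have hpos : ∀ᵐ x ∂(volume.restrict D.Ω), 0 < ζ x := by
      filter_upwards [h, hσ0, ae_lt_top' hm htop] with x hx hx0 hlt
      refine lt_of_le_of_ne hx fun h0 => ?_
      have : 0 < ‖σ x‖ := norm_pos_iff.2 hx0
      rw [if_pos hx, ← h0, ENNReal.ofReal_zero,
        ENNReal.div_zero (ENNReal.ofReal_pos.2 (by positivity)).ne'] at hlt
      exact lt_irrefl _ hlt
    refine ⟨hpos, ?_⟩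
    rw [lintegral_pos_part_of_pos hpos] at htop
    rw [← lintegral_ofReal_ne_top_iff_integrable (aestronglyMeasurable_quotient hσ hζ.1)]
    · exact htop
    · filter_upwards [hpos] with x hx
      simp only [Pi.zero_apply]
      positivity

/-- For `ζ < 0` the dual energy is `+∞`, unless `|σ|² / ζ` is integrable. -/
lemma dualEnergy_eq_top_or (hσ : AEStronglyMeasurable σ (volume.restrict D.Ω))
    (hζ : MemLp ζ 2 (volume.restrict D.Ω)) (h : ∀ᵐ x ∂(volume.restrict D.Ω), ζ x < 0) :
    dualEnergy D ν lam σ ζ = ⊤ ∨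
      Integrable (fun x => ‖σ x‖ ^ 2 / (2 * ζ x)) (volume.restrict D.Ω) := by
  by_cases htop : (∫⁻ x in D.Ω, ENNReal.ofReal (-(‖σ x‖ ^ 2 / (2 * ζ x)))) = ⊤
  · left
    rw [dualEnergy, lintegral_pos_part_of_neg h, lintegral_neg_part_of_neg h, htop]
    simp
  · right
    rw [← integrable_neg_iff]
    refine (lintegral_ofReal_ne_top_iff_integrable
      (aestronglyMeasurable_quotient hσ hζ.1).neg ?_).1 htop
    filter_upwards [h] with x hx
    simp only [Pi.zero_apply, Pi.neg_apply]
    rw [← div_neg]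
    have : 0 < -(2 * ζ x) := by linarith
    positivity

end DualEnergy

/-! ### The branches of roots -/

section Branches

variable {n : ℕ} {D : BoundaryDomain n} {p q β : ℝ≥0∞} {f t : E n → ℝ} {σ : E n → E n}
  {ν lam : ℝ} {ζ : E n → ℝ}

lemma BoundaryDomain.ae_of_forall_closure (D : BoundaryDomain n) {P : E n → Prop}
    (h : ∀ x ∈ closure D.Ω, P x) : ∀ᵐ x ∂(volume.restrict D.Ω), P x :=
  (ae_restrict_iff' D.isOpen.measurableSet).2 (.of_forall fun x hx => h x (subset_closure hx))

lemma DAE.ne_zero {s : E n} {z : ℝ} (hν : 0 < ν) (hlam : 0 < lam) (hz : 0 < z)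
    (h : DAE ν lam s z) : s ≠ 0 := by
  rintro rfl
  unfold DAE at h
  have : 0 < 2 * z ^ 2 * (lam + z / ν) := by positivity
  rw [norm_zero, zero_pow two_ne_zero] at h
  exact this.ne h

lemma mem_dualSet_of_continuousOn (hζ : ContinuousOn ζ (closure D.Ω)) {I : Set ℝ}
    (h : ∀ x ∈ closure D.Ω, ζ x ∈ I) : ζ ∈ dualSet D I :=
  ⟨memLp_of_continuousOn_closure D hζ 2, D.ae_of_forall_closure h⟩

lemma integrable_quotient_of_continuousOn (hσ : ContinuousOn σ (closure D.Ω))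
    (hζ : ContinuousOn ζ (closure D.Ω)) (h0 : ∀ x ∈ closure D.Ω, ζ x ≠ 0) :
    Integrable (fun x => ‖σ x‖ ^ 2 / (2 * ζ x)) (volume.restrict D.Ω) := by
  refine (memLp_of_continuousOn_closure D ?_ 1).integrable le_rfl
  exact (hσ.norm.pow 2).div (continuousOn_const.mul hζ) fun x hx =>
    mul_ne_zero two_ne_zero (h0 x hx)

/-- Equality of primal and dual energy at corresponding critical points. -/
lemma energy_eq_integral_dualDensity (h : IsData D p q β f t σ) (hν : 0 < ν)
    (hζ : ContinuousOn ζ (closure D.Ω)) (h0 : ∀ x ∈ closure D.Ω, ζ x ≠ 0)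
    (hD : ∀ x ∈ closure D.Ω, DAE ν lam (σ x) (ζ x)) (u : SpaceU0 D p q β)
    (hu : IsPathIntegral D.Ω σ ζ u.toFun) :
    energy ν lam f t u = ∫ x in D.Ω, dualDensity ν lam (σ x) (ζ x) := by
  rw [energy_eq h]
  refine integral_congr_ae ?_
  filter_upwards [u.grad_eq_of_isPathIntegral ((hζ.inv₀ h0).smul h.σ_continuousOn) hu,
    D.ae_of_forall_closure h0, D.ae_of_forall_closure hD] with x hx hx0 hxD
  rw [hx, W_critical hν hx0 hxD]

/-- The positive branch: global minimality and global duality. -/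
lemma positive_branch (h : IsData D p q β f t σ) (hν : 0 < ν) (hlam : 0 < lam)
    (hζ : ContinuousOn ζ (closure D.Ω)) (hpos : ∀ x ∈ closure D.Ω, 0 < ζ x)
    (hD : ∀ x ∈ closure D.Ω, DAE ν lam (σ x) (ζ x)) {I : Set ℝ} (hI : Ioi 0 ⊆ I)
    (hI' : I ⊆ Ici 0) :
    ζ ∈ dualSet D I ∧ IsMaxOn (dualEnergy D ν lam σ) (dualSet D I) ζ ∧
      ∀ u : SpaceU0 D p q β, IsPathIntegral D.Ω σ ζ u.toFun →
        (∀ v : SpaceU0 D p q β, energy ν lam f t u ≤ energy ν lam f t v) ∧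
        (energy ν lam f t u : EReal) = dualEnergy D ν lam σ ζ := by
  have h0 : ∀ x ∈ closure D.Ω, ζ x ≠ 0 := fun x hx => (hpos x hx).ne'
  have hi := integrable_quotient_of_continuousOn h.σ_continuousOn hζ h0
  have hζ2 := memLp_of_continuousOn_closure D hζ 2
  have hval := dualEnergy_of_pos (ν := ν) (lam := lam) hζ2 (D.ae_of_forall_closure hpos) hi
  refine ⟨mem_dualSet_of_continuousOn hζ fun x hx => hI (hpos x hx), ?_, fun u hu => ⟨?_, ?_⟩⟩
  · rintro ξ ⟨hξ2, hξI⟩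
    change dualEnergy D ν lam σ ξ ≤ dualEnergy D ν lam σ ζ
    rcases dualEnergy_eq_bot_or (ν := ν) (lam := lam)
      (aestronglyMeasurable_of_continuousOn_closure D h.σ_continuousOn)
      (D.ae_of_forall_closure fun x hx => (hD x hx).ne_zero hν hlam (hpos x hx)) hξ2
      (hξI.mono fun x hx => hI' hx) with hbot | ⟨hξpos, hξi⟩
    · rw [hbot]; exact bot_le
    · rw [dualEnergy_of_pos hξ2 hξpos hξi, hval, EReal.coe_le_coe_iff]
      refine integral_mono_ae (integrable_dualDensity hξ2 hξi) (integrable_dualDensity hζ2 hi) ?_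
      filter_upwards [hξpos, D.ae_of_forall_closure h0, D.ae_of_forall_closure hD] with x hx hx0 hxD
      rw [← W_critical hν hx0 hxD]
      exact dualDensity_le hν hx _
  · intro v
    rw [energy_eq_integral_dualDensity h hν hζ h0 hD u hu, energy_eq h]
    refine integral_mono_ae (integrable_dualDensity hζ2 hi)
      (integrable_energy_density h.σ_continuousOn _) ?_
    filter_upwards [D.ae_of_forall_closure hpos] with x hx
    exact dualDensity_le hν hx _
  · rw [hval, energy_eq_integral_dualDensity h hν hζ h0 hD u hu]

lemma exists_gap {g : E n → ℝ} (hg : ContinuousOn g (closure D.Ω))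
    (h : ∀ x ∈ closure D.Ω, 0 < g x) : ∃ ε > 0, ∀ x ∈ closure D.Ω, ε ≤ g x := by
  obtain ⟨x, hx, hmin⟩ := D.isCompact_closure.exists_isMinOn
    (D.isConnected.nonempty.mono subset_closure) hg
  exact ⟨g x, h x hx, hmin⟩

/-- The branch of the smallest root: the dual density has a maximum and `W(y) - ⟨σ, y⟩` a local
maximum. -/
lemma smallest_branch (h : IsData D p q β f t σ) (hν : 0 < ν) (hlam : 0 < lam)
    (hζ : ContinuousOn ζ (closure D.Ω))
    (hI : ∀ x ∈ closure D.Ω, ζ x ∈ Ioo (-(ν * lam)) (-(2 * ν * lam / 3)))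
    (hD : ∀ x ∈ closure D.Ω, DAE ν lam (σ x) (ζ x)) :
    ζ ∈ dualSet D (Ioo (-(ν * lam)) (-(2 * ν * lam / 3))) ∧
      IsMaxOn (dualEnergy D ν lam σ) (dualSet D (Ioo (-(ν * lam)) (-(2 * ν * lam / 3)))) ζ ∧
      ∀ u : SpaceU0 D p q β, IsPathIntegral D.Ω σ ζ u.toFun →
        IsWeakLocalMax ν lam f t u ∧
        (energy ν lam f t u : EReal) = dualEnergy D ν lam σ ζ := by
  have hνl : 0 < ν * lam := by positivity
  have hneg : ∀ x ∈ closure D.Ω, ζ x < 0 := fun x hx => by linarith [(hI x hx).2]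
  have h0 : ∀ x ∈ closure D.Ω, ζ x ≠ 0 := fun x hx => (hneg x hx).ne
  have hi := integrable_quotient_of_continuousOn h.σ_continuousOn hζ h0
  have hζ2 := memLp_of_continuousOn_closure D hζ 2
  have hval := dualEnergy_of_neg (ν := ν) (lam := lam) hζ2 (D.ae_of_forall_closure hneg) hi
  refine ⟨mem_dualSet_of_continuousOn hζ hI, ?_, fun u hu => ⟨?_, ?_⟩⟩
  · rintro ξ ⟨hξ2, hξI⟩
    change dualEnergy D ν lam σ ξ ≤ dualEnergy D ν lam σ ζ
    have hξneg : ∀ᵐ x ∂(volume.restrict D.Ω), ξ x < 0 := hξI.mono fun x hx => by linarith [hx.2]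
    -- `ξ` stays away from `0`, so that `|σ|² / ξ` is bounded
    have hξi : Integrable (fun x => ‖σ x‖ ^ 2 / (2 * ξ x)) (volume.restrict D.Ω) := by
      obtain ⟨C, hC⟩ := exists_bound_of_continuousOn_closure D h.σ_continuousOn
      refine (memLp_top_of_bound (aestronglyMeasurable_quotient
        (aestronglyMeasurable_of_continuousOn_closure D h.σ_continuousOn) hξ2.1)
        (C ^ 2 / (2 * (2 * ν * lam / 3))) ?_).integrable le_top
      filter_upwards [hC, hξI] with x hx hxI
      rw [norm_div, norm_pow, norm_norm, norm_mul, Real.norm_of_nonneg (zero_le_two),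
        Real.norm_of_nonpos (by linarith [hxI.2])]
      have : 2 * ν * lam / 3 ≤ -ξ x := by linarith [hxI.2]
      have h23 : 0 < 2 * ν * lam / 3 := by positivity
      gcongr
    rw [dualEnergy_of_neg hξ2 hξneg hξi, hval, EReal.coe_le_coe_iff]
    refine integral_mono_ae (integrable_dualDensity hξ2 hξi) (integrable_dualDensity hζ2 hi) ?_
    filter_upwards [hξI, D.ae_of_forall_closure hI, D.ae_of_forall_closure hD] with x hx hxI hxD
    rw [← sub_nonneg, dualDensity_sub hν (by linarith [hx.2]) hxD]
    have h1 : 2 * lam + (2 * ζ x + ξ x) / ν < 0 := by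
      have : (2 * ζ x + ξ x) / ν < -(2 * lam) := by
        rw [div_lt_iff₀ hν]
        linarith [hx.2, hxI.2]
      linarith
    have h2 : (ζ x - ξ x) ^ 2 / (2 * ξ x) ≤ 0 :=
      div_nonpos_of_nonneg_of_nonpos (sq_nonneg _) (by linarith [hx.2])
    exact mul_nonneg_of_nonpos_of_nonpos h2 h1.le
  -- the Hessian of `W` in the direction of `σ` is bounded away from `0` on the compact closure
  · obtain ⟨ε, hε, hgap⟩ := exists_gap (D := D) (g := fun x => -(3 * ζ x + 2 * ν * lam))
      (by fun_prop) (fun x hx => by linarith [(hI x hx).2])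
    have hc : 0 < ν * (√(2 * lam) + 1) := by positivity
    refine ⟨min 1 (ε / (ν * (√(2 * lam) + 1))), by positivity, fun v hv => ?_⟩
    rw [energy_eq_integral_dualDensity h hν hζ h0 hD u hu, energy_eq h]
    refine integral_mono_ae (integrable_energy_density h.σ_continuousOn _)
      (integrable_dualDensity hζ2 hi) ?_
    filter_upwards [u.grad_eq_of_isPathIntegral ((hζ.inv₀ h0).smul h.σ_continuousOn) hu, hv,
      D.ae_of_forall_closure hD, D.ae_of_forall_closure hgap] with x hx hxv hxD hxg
    have := W_sub_inner_le_near hν hlam hxD (ε := ε)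
      (δ := min 1 (ε / (ν * (√(2 * lam) + 1)))) (by linarith) hε.le (min_le_left _ _) (by
        rw [mul_comm, ← le_div_iff₀ hc]; exact min_le_right _ _) hxv.2.le
    rwa [hx, add_sub_cancel] at this
  · rw [hval, energy_eq_integral_dualDensity h hν hζ h0 hD u hu]

/-- The branch of the middle root in dimension one: the dual density has a minimum and
`W(y) - ⟨σ, y⟩` a local minimum. -/
lemma middle_branch (hn : n = 1) (h : IsData D p q β f t σ) (hν : 0 < ν)
    (hζ : ContinuousOn ζ (closure D.Ω))
    (hI : ∀ x ∈ closure D.Ω, ζ x ∈ Ioo (-(2 * ν * lam / 3)) 0)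
    (hD : ∀ x ∈ closure D.Ω, DAE ν lam (σ x) (ζ x)) :
    ζ ∈ dualSet D (Ioo (-(2 * ν * lam / 3)) 0) ∧
      IsMinOn (dualEnergy D ν lam σ) (dualSet D (Ioo (-(2 * ν * lam / 3)) 0)) ζ ∧
      ∀ u : SpaceU0 D p q β, IsPathIntegral D.Ω σ ζ u.toFun →
        IsWeakLocalMin ν lam f t u ∧
        (energy ν lam f t u : EReal) = dualEnergy D ν lam σ ζ := by
  have hneg : ∀ x ∈ closure D.Ω, ζ x < 0 := fun x hx => (hI x hx).2
  have h0 : ∀ x ∈ closure D.Ω, ζ x ≠ 0 := fun x hx => (hneg x hx).ne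
  have hi := integrable_quotient_of_continuousOn h.σ_continuousOn hζ h0
  have hζ2 := memLp_of_continuousOn_closure D hζ 2
  have hval := dualEnergy_of_neg (ν := ν) (lam := lam) hζ2 (D.ae_of_forall_closure hneg) hi
  refine ⟨mem_dualSet_of_continuousOn hζ hI, ?_, fun u hu => ⟨?_, ?_⟩⟩
  · rintro ξ ⟨hξ2, hξI⟩
    change dualEnergy D ν lam σ ζ ≤ dualEnergy D ν lam σ ξ
    have hξneg : ∀ᵐ x ∂(volume.restrict D.Ω), ξ x < 0 := hξI.mono fun x hx => hx.2
    rcases dualEnergy_eq_top_or (ν := ν) (lam := lam)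
      (aestronglyMeasurable_of_continuousOn_closure D h.σ_continuousOn) hξ2 hξneg with htop | hξi
    · rw [htop]; exact le_top
    rw [dualEnergy_of_neg hξ2 hξneg hξi, hval, EReal.coe_le_coe_iff]
    refine integral_mono_ae (integrable_dualDensity hζ2 hi) (integrable_dualDensity hξ2 hξi) ?_
    filter_upwards [hξI, D.ae_of_forall_closure hI, D.ae_of_forall_closure hD] with x hx hxI hxD
    rw [← sub_nonpos, dualDensity_sub hν hx.2.ne hxD]
    have h1 : 0 < 2 * lam + (2 * ζ x + ξ x) / ν := by
      have : -(2 * lam) < (2 * ζ x + ξ x) / ν := by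
        rw [lt_div_iff₀ hν]
        linarith [hx.1, hxI.1]
      linarith
    have h2 : (ζ x - ξ x) ^ 2 / (2 * ξ x) ≤ 0 :=
      div_nonpos_of_nonneg_of_nonpos (sq_nonneg _) (by linarith [hx.2])
    exact mul_nonpos_of_nonpos_of_nonneg h2 h1.le
  · obtain ⟨ε, hε, hgap⟩ := exists_gap (D := D) (g := fun x => 3 * ζ x + 2 * ν * lam)
      (by fun_prop) (fun x hx => by linarith [(hI x hx).1])
    have hc : 0 < ν * (√(2 * lam) + 1) := by positivity
    refine ⟨ε / (ν * (√(2 * lam) + 1)), by positivity, fun v hv => ?_⟩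
    rw [energy_eq_integral_dualDensity h hν hζ h0 hD u hu, energy_eq h]
    refine integral_mono_ae (integrable_dualDensity hζ2 hi)
      (integrable_energy_density h.σ_continuousOn _) ?_
    filter_upwards [u.grad_eq_of_isPathIntegral ((hζ.inv₀ h0).smul h.σ_continuousOn) hu, hv,
      D.ae_of_forall_closure hD, D.ae_of_forall_closure hgap,
      D.ae_of_forall_closure hneg] with x hx hxv hxD hxg hxn
    have := le_W_sub_inner_near hn hν hxD hxn (ε := ε)
      (δ := ε / (ν * (√(2 * lam) + 1))) hxg (by
        rw [mul_div_assoc', div_le_iff₀ hc, mul_comm]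
        gcongr
        linarith) hxv.2.le
    rwa [hx, add_sub_cancel] at this
  · rw [hval, energy_eq_integral_dualDensity h hν hζ h0 hD u hu]

/-- If `|σ|²` exceeds the local maximum of the cubic, the root function is continuous, as the cubic
is strictly increasing on `(0, ∞)`, and the positive branch gives all claims. -/
lemma one_root_case (h : IsData D p q β f t σ) (hν : 0 < ν) (hlam : 0 < lam)
    (hσ : ∀ x ∈ closure D.Ω, 8 * lam ^ 3 * ν ^ 2 / 27 < ‖σ x‖ ^ 2) :
    ∃ ζ : E n → ℝ,
      (∀ x ∈ closure D.Ω, 0 < ζ x ∧ ∀ z : ℝ, DAE ν lam (σ x) z ↔ z = ζ x) ∧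
      ζ ∈ dualSet D (Ici 0) ∧
      IsMaxOn (dualEnergy D ν lam σ) (dualSet D (Ici 0)) ζ ∧
      ∀ ubar : SpaceU0 D p q β, IsPathIntegral D.Ω σ ζ ubar.toFun →
        (∀ u : SpaceU0 D p q β, energy ν lam f t ubar ≤ energy ν lam f t u) ∧
        (energy ν lam f t ubar : EReal) = dualEnergy D ν lam σ ζ := by
  have hex : ∀ x, ∃ z, x ∈ closure D.Ω → 0 < z ∧ ∀ w, DAE ν lam (σ x) w ↔ w = z := fun x => by
    by_cases hx : x ∈ closure D.Ω
    · obtain ⟨z, hz⟩ := exists_unique_root hν hlam (hσ x hx)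
      exact ⟨z, fun _ => hz⟩
    · exact ⟨0, fun h => absurd h hx⟩
  choose ζ hζ using hex
  have hD : ∀ x ∈ closure D.Ω, DAE ν lam (σ x) (ζ x) := fun x hx => ((hζ x hx).2 _).2 rfl
  have hpos : ∀ x ∈ closure D.Ω, 0 < ζ x := fun x hx => (hζ x hx).1
  have hc : ContinuousOn ζ (closure D.Ω) :=
    continuousOn_of_strictMonoOn_comp isOpen_Ioi
      ((cubic_strictMonoOn_Ici hν hlam).mono Ioi_subset_Ici_self) hpos
      ((h.σ_continuousOn.norm.pow 2).congr fun x hx => (hD x hx).symm)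
  exact ⟨ζ, hζ, positive_branch h hν hlam hc hpos hD Ioi_subset_Ici_self subset_rfl⟩

/-- If `|σ|²` lies below the local maximum of the cubic, each of its three roots lies in an open
interval of strict monotonicity, so that the root functions are continuous. -/
lemma three_roots_case (h : IsData D p q β f t σ) (hν : 0 < ν) (hlam : 0 < lam)
    (hσ : ∀ x ∈ closure D.Ω, 0 < ‖σ x‖ ^ 2 ∧ ‖σ x‖ ^ 2 < 8 * lam ^ 3 * ν ^ 2 / 27) :
    ∃ ζ₁ ζ₂ ζ₃ : E n → ℝ,
      (∀ x ∈ closure D.Ω,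
        (0 < ζ₁ x ∧ ζ₂ x < 0 ∧ -(2 * ν * lam / 3) < ζ₂ x ∧ ζ₃ x < -(2 * ν * lam / 3) ∧
          -(ν * lam) < ζ₃ x) ∧
        ∀ z : ℝ, DAE ν lam (σ x) z ↔ z = ζ₁ x ∨ z = ζ₂ x ∨ z = ζ₃ x) ∧
      (ζ₁ ∈ dualSet D (Ioi 0) ∧
        IsMaxOn (dualEnergy D ν lam σ) (dualSet D (Ioi 0)) ζ₁ ∧
        ∀ u₁ : SpaceU0 D p q β, IsPathIntegral D.Ω σ ζ₁ u₁.toFun →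
          (∀ u : SpaceU0 D p q β, energy ν lam f t u₁ ≤ energy ν lam f t u) ∧
          (energy ν lam f t u₁ : EReal) = dualEnergy D ν lam σ ζ₁) ∧
      (ζ₃ ∈ dualSet D (Ioo (-(ν * lam)) (-(2 * ν * lam / 3))) ∧
        IsMaxOn (dualEnergy D ν lam σ)
          (dualSet D (Ioo (-(ν * lam)) (-(2 * ν * lam / 3)))) ζ₃ ∧
        ∀ u₃ : SpaceU0 D p q β, IsPathIntegral D.Ω σ ζ₃ u₃.toFun →
          IsWeakLocalMax ν lam f t u₃ ∧
          (energy ν lam f t u₃ : EReal) = dualEnergy D ν lam σ ζ₃) ∧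
      (n = 1 →
        ζ₂ ∈ dualSet D (Ioo (-(2 * ν * lam / 3)) 0) ∧
        IsMinOn (dualEnergy D ν lam σ) (dualSet D (Ioo (-(2 * ν * lam / 3)) 0)) ζ₂ ∧
        ∀ u₂ : SpaceU0 D p q β, IsPathIntegral D.Ω σ ζ₂ u₂.toFun →
          IsWeakLocalMin ν lam f t u₂ ∧
          (energy ν lam f t u₂ : EReal) = dualEnergy D ν lam σ ζ₂) := by
  have hex : ∀ x, ∃ z₁ z₂ z₃, x ∈ closure D.Ω →
      (0 < z₁ ∧ z₂ < 0 ∧ -(2 * ν * lam / 3) < z₂ ∧ z₃ < -(2 * ν * lam / 3) ∧ -(ν * lam) < z₃) ∧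
        ∀ w, DAE ν lam (σ x) w ↔ w = z₁ ∨ w = z₂ ∨ w = z₃ := fun x => by
    by_cases hx : x ∈ closure D.Ω
    · obtain ⟨z₁, z₂, z₃, hz⟩ := exists_three_roots hν hlam (hσ x hx).1 (hσ x hx).2
      exact ⟨z₁, z₂, z₃, fun _ => hz⟩
    · exact ⟨0, 0, 0, fun h => absurd h hx⟩
  choose ζ₁ ζ₂ ζ₃ hζ using hex
  have hD₁ : ∀ x ∈ closure D.Ω, DAE ν lam (σ x) (ζ₁ x) := fun x hx =>
    ((hζ x hx).2 _).2 (Or.inl rfl)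
  have hD₂ : ∀ x ∈ closure D.Ω, DAE ν lam (σ x) (ζ₂ x) := fun x hx =>
    ((hζ x hx).2 _).2 (Or.inr (Or.inl rfl))
  have hD₃ : ∀ x ∈ closure D.Ω, DAE ν lam (σ x) (ζ₃ x) := fun x hx =>
    ((hζ x hx).2 _).2 (Or.inr (Or.inr rfl))
  have hI₁ : ∀ x ∈ closure D.Ω, 0 < ζ₁ x := fun x hx => (hζ x hx).1.1
  have hI₂ : ∀ x ∈ closure D.Ω, ζ₂ x ∈ Ioo (-(2 * ν * lam / 3)) 0 := fun x hx =>
    ⟨(hζ x hx).1.2.2.1, (hζ x hx).1.2.1⟩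
  have hI₃ : ∀ x ∈ closure D.Ω, ζ₃ x ∈ Ioo (-(ν * lam)) (-(2 * ν * lam / 3)) := fun x hx =>
    ⟨(hζ x hx).1.2.2.2.2, (hζ x hx).1.2.2.2.1⟩
  have hσ2 := h.σ_continuousOn.norm.pow 2
  have hc₁ : ContinuousOn ζ₁ (closure D.Ω) :=
    continuousOn_of_strictMonoOn_comp isOpen_Ioi
      ((cubic_strictMonoOn_Ici hν hlam).mono Ioi_subset_Ici_self) hI₁
      (hσ2.congr fun x hx => (hD₁ x hx).symm)
  have hc₂ : ContinuousOn ζ₂ (closure D.Ω) :=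
    continuousOn_of_strictAntiOn_comp isOpen_Ioo
      ((cubic_strictAntiOn_Icc hν hlam).mono Ioo_subset_Icc_self) hI₂
      (hσ2.congr fun x hx => (hD₂ x hx).symm)
  have hc₃ : ContinuousOn ζ₃ (closure D.Ω) :=
    continuousOn_of_strictMonoOn_comp isOpen_Ioo
      ((cubic_strictMonoOn_Iic hν hlam).mono fun x hx => hx.2.le) hI₃
      (hσ2.congr fun x hx => (hD₃ x hx).symm)
  exact ⟨ζ₁, ζ₂, ζ₃, hζ, positive_branch h hν hlam hc₁ hI₁ hD₁ subset_rfl Ioi_subset_Ici_self,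
    smallest_branch h hν hlam hc₃ hI₃ hD₃, fun hn => middle_branch hn h hν hc₂ hI₂ hD₂⟩

end Branches

/-! ### Hausdorff measure of spherical caps -/

section Hausdorff

variable {X Y : Type*} [EMetricSpace X] [MeasurableSpace X] [BorelSpace X]
  [EMetricSpace Y] [MeasurableSpace Y] [BorelSpace Y]

lemma euclideanHausdorffMeasure_image_le {K : NNReal} {f : X → Y} {s : Set X}
    (h : LipschitzOnWith K f s) (d : ℕ) :
    (μHE[d] : Measure Y) (f '' s) ≤ (K : ℝ≥0∞) ^ d * (μHE[d] : Measure X) s := by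
  simp_rw [Measure.euclideanHausdorffMeasure_def, Measure.smul_apply, ENNReal.smul_def, smul_eq_mul]
  have := h.hausdorffMeasure_image_le (d := d) (by positivity)
  rw [ENNReal.rpow_natCast] at this
  calc _ ≤ _ := mul_le_mul_right this _
    _ = _ := by ring

end Hausdorff

section Cap

variable {n : ℕ}

/-- The disc of radius `r` around the origin in the hyperplane orthogonal to `e`. -/
def disc (e : E n) (r : ℝ) : Set (E n) := {y | ⟪e, y⟫ = 0 ∧ ‖y‖ ≤ r}

/-- The cone over a flat disc: apex at the origin, axis `e`, height `b`, and radius `k h` at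
height `h`. -/
def flatCone (e : E n) (k b : ℝ) : Set (E n) :=
  {x | ⟪e, x⟫ ∈ Ioo 0 b ∧ ‖x - ⟪e, x⟫ • e‖ ≤ k * ⟪e, x⟫}

/-- The cap of the unit sphere with center `e`, described by its height `c`. -/
def cap (e : E n) (c : ℝ) : Set (E n) := {x | ‖x‖ = 1 ∧ c ≤ ⟪e, x⟫}

open scoped Pointwise in
lemma surface_disc (e : E n) {r : ℝ} (hr : 0 < r) :
    surface n (disc e r) = ENNReal.ofReal (r ^ (n - 1)) * surface n (disc e 1) := by
  have h : disc e r = r • disc e 1 := by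
    ext y
    rw [mem_smul_set_iff_inv_smul_mem₀ hr.ne']
    simp only [disc, mem_ofPred_eq, inner_smul_right, norm_smul, norm_inv,
      Real.norm_of_nonneg hr.le, mul_eq_zero, inv_eq_zero, hr.ne', false_or]
    rw [inv_mul_le_one₀ hr]
  rw [h, surface, Measure.euclideanHausdorffMeasure_smul₀ _ hr.ne', ENNReal.smul_def, smul_eq_mul]
  congr 1
  rw [ENNReal.coe_pow, ENNReal.ofReal_pow hr.le]
  congr 1
  change ‖r‖ₑ = _
  rw [← ofReal_norm, Real.norm_of_nonneg hr.le]

lemma finrank_orthogonal {e : E n} (he : ‖e‖ = 1) :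
    Module.finrank ℝ (Submodule.span ℝ {e})ᗮ = n - 1 := by
  have h0 : e ≠ 0 := by rintro rfl; simp at he
  have h := (Submodule.span ℝ {e}).finrank_add_finrank_orthogonal
  rw [finrank_span_singleton h0, finrank_euclideanSpace_fin] at h
  omega

lemma surface_disc_one {e : E n} (he : ‖e‖ = 1) :
    surface n (disc e 1) = volume (Metric.closedBall (0 : (Submodule.span ℝ {e})ᗮ) 1) := by
  have h : disc e 1 = Subtype.val '' Metric.closedBall (0 : (Submodule.span ℝ {e})ᗮ) 1 := by
    ext y
    simp only [disc, mem_ofPred_eq, mem_image, Metric.mem_closedBall, dist_zero_right,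
      Subtype.exists, Submodule.mem_orthogonal_singleton_iff_inner_right]
    constructor
    · rintro ⟨h1, h2⟩
      exact ⟨y, h1, h2, rfl⟩
    · rintro ⟨y, h1, h2, rfl⟩
      exact ⟨h1, h2⟩
  rw [h, surface, isometry_subtype_coe.euclideanHausdorffMeasure_image, ← finrank_orthogonal he,
    InnerProductSpace.euclideanHausdorffMeasure_eq_volume]

lemma surface_disc_one_pos {e : E n} (he : ‖e‖ = 1) : 0 < surface n (disc e 1) := by
  rw [surface_disc_one he]
  exact Metric.measure_closedBall_pos _ _ one_pos

lemma surface_disc_one_lt_top {e : E n} (he : ‖e‖ = 1) : surface n (disc e 1) < ⊤ := by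
  rw [surface_disc_one he]
  exact measure_closedBall_lt_top

lemma measurableSet_flatCone (e : E n) (k b : ℝ) : MeasurableSet (flatCone e k b) := by
  have h1 : Measurable fun x : E n => ⟪e, x⟫ := by fun_prop
  have h2 : MeasurableSet {x : E n | ‖x - ⟪e, x⟫ • e‖ ≤ k * ⟪e, x⟫} :=
    measurableSet_le (by fun_prop) (by fun_prop)
  exact (h1 measurableSet_Ioo).inter h2

lemma flatCone_slice {e : E n} (he : ‖e‖ = 1) (k b h : ℝ) :
    flatCone e k b ∩ AffineSubspace.mk' (h • e +ᵥ (0 : E n)) (Submodule.span ℝ {e})ᗮ =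
      if h ∈ Ioo 0 b then (fun y => h • e + y) '' disc e (k * h) else ∅ := by
  have hee : ⟪e, e⟫ = 1 := by rw [real_inner_self_eq_norm_sq, he]; norm_num
  have hmem : ∀ x : E n, x ∈ AffineSubspace.mk' (h • e +ᵥ (0 : E n)) (Submodule.span ℝ {e})ᗮ ↔
      ⟪e, x⟫ = h := by
    intro x
    rw [AffineSubspace.mem_mk', Submodule.mem_orthogonal_singleton_iff_inner_right]
    simp only [vadd_eq_add, vsub_eq_sub, add_zero, inner_sub_right, inner_smul_right, hee]
    constructor <;> intro h <;> linarith
  ext x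
  rw [mem_inter_iff, SetLike.mem_coe, hmem]
  split_ifs with hh
  · simp only [flatCone, disc, mem_ofPred_eq, mem_image]
    constructor
    · rintro ⟨⟨h1, h2⟩, rfl⟩
      refine ⟨x - ⟪e, x⟫ • e, ⟨?_, h2⟩, by abel⟩
      rw [inner_sub_right, inner_smul_right, hee]; ring
    · rintro ⟨y, ⟨hy1, hy2⟩, rfl⟩
      have : ⟪e, h • e + y⟫ = h := by
        rw [inner_add_right, inner_smul_right, hee, hy1]; ring
      rw [this]
      exact ⟨⟨hh, by simpa using hy2⟩, rfl⟩
  · simp only [mem_empty_iff_false, iff_false, not_and]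
    rintro ⟨h1, -⟩ rfl
    exact hh h1

lemma volume_flatCone (hn : 1 ≤ n) {e : E n} (he : ‖e‖ = 1) {k b : ℝ} (hk : 0 < k) (hb : 0 < b) :
    volume (flatCone e k b) =
      ENNReal.ofReal (k ^ (n - 1) * b ^ n / n) * surface n (disc e 1) := by
  have h0 : e ≠ 0 := by rintro rfl; simp at he
  have h := EuclideanGeometry.euclideanHausdorffMeasure_eq_lintegral (0 : E n) h0
    (measurableSet_flatCone e k b)
  rw [InnerProductSpace.euclideanHausdorffMeasure_eq_volume, finrank_euclideanSpace_fin] at h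
  rw [h]
  have he' : ‖e‖ₑ = 1 := by rw [← ofReal_norm, he, ENNReal.ofReal_one]
  rw [he', one_mul]
  have hslice : ∀ x : ℝ, (μHE[n - 1] : Measure (E n)) (flatCone e k b ∩
      AffineSubspace.mk' (x • e +ᵥ (0 : E n)) (Submodule.span ℝ {e})ᗮ) =
      (Ioo 0 b).indicator
        (fun x => ENNReal.ofReal ((k * x) ^ (n - 1)) * surface n (disc e 1)) x := by
    intro x
    rw [flatCone_slice he]
    split_ifs with hx
    · rw [indicator_of_mem hx, ← surface_disc e (mul_pos hk hx.1), surface,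
        (isometry_add_left (x • e)).euclideanHausdorffMeasure_image]
    · rw [indicator_of_notMem hx, measure_empty]
  simp_rw [hslice]
  rw [lintegral_indicator measurableSet_Ioo, lintegral_mul_const _ (by fun_prop)]
  congr 1
  have hint : IntegrableOn (fun x : ℝ => (k * x) ^ (n - 1)) (Ioo 0 b) :=
    (Continuous.integrableOn_Icc (by fun_prop)).mono_set Ioo_subset_Icc_self
  rw [← ofReal_integral_eq_lintegral_ofReal hint]
  · congr 1
    rw [← integral_Ioc_eq_integral_Ioo, ← intervalIntegral.integral_of_le hb.le]
    simp_rw [mul_pow]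
    rw [intervalIntegral.integral_const_mul, integral_pow]
    have : n - 1 + 1 = n := by omega
    rw [this, zero_pow (by omega), sub_zero, mul_div_assoc]
    congr 2
    rw [← this]; push_cast; simp
  · refine (ae_restrict_iff' measurableSet_Ioo).2 (.of_forall fun x hx => ?_)
    have : 0 < k * x := mul_pos hk hx.1
    simp only [Pi.zero_apply]
    positivity

end Cap

section CapBounds

variable {n : ℕ} {e : E n}

lemma norm_sub_inner_smul_sq (he : ‖e‖ = 1) (x : E n) :
    ‖x - ⟪e, x⟫ • e‖ ^ 2 = ‖x‖ ^ 2 - ⟪e, x⟫ ^ 2 := by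
  rw [norm_sub_sq_real, inner_smul_right, real_inner_comm, norm_smul, he, mul_one,
    Real.norm_eq_abs, sq_abs]
  ring

lemma norm_add_smul_sq (he : ‖e‖ = 1) {y : E n} (hy : ⟪e, y⟫ = 0) (a : ℝ) :
    ‖y + a • e‖ ^ 2 = ‖y‖ ^ 2 + a ^ 2 := by
  rw [norm_add_sq_real, inner_smul_right, real_inner_comm, hy, norm_smul, he, mul_one,
    Real.norm_eq_abs, sq_abs]
  ring

/-- The orthogonal projection onto the hyperplane of the disc does not increase distances and maps
the cap onto a disc. -/
lemma surface_disc_le_surface_cap (he : ‖e‖ = 1) {c : ℝ} (hc : 0 ≤ c) (hc1 : c ≤ 1) :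
    surface n (disc e (√(1 - c ^ 2))) ≤ surface n (cap e c) := by
  set P : E n → E n := fun x => x - ⟪e, x⟫ • e with hP
  have hL : LipschitzOnWith 1 P (cap e c) := by
    refine LipschitzOnWith.of_dist_le_mul fun x _ y _ => ?_
    rw [NNReal.coe_one, one_mul, dist_eq_norm, dist_eq_norm]
    have h1 : P x - P y = (x - y) - ⟪e, x - y⟫ • e := by
      simp only [hP, inner_sub_right, sub_smul]; abel
    rw [h1, ← sq_le_sq₀ (norm_nonneg _) (norm_nonneg _), norm_sub_inner_smul_sq he]
    nlinarith [sq_nonneg ⟪e, x - y⟫]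
  have hsub : disc e (√(1 - c ^ 2)) ⊆ P '' cap e c := by
    rintro y ⟨hy, hyr⟩
    have hc2 : 0 ≤ 1 - c ^ 2 := by nlinarith
    have h2 : ‖y‖ ^ 2 ≤ 1 - c ^ 2 := by
      rw [← Real.sq_sqrt hc2]; gcongr
    have h3 : ⟪e, y + √(1 - ‖y‖ ^ 2) • e⟫ = √(1 - ‖y‖ ^ 2) := by
      rw [inner_add_right, hy, inner_smul_right, real_inner_self_eq_norm_sq, he]; ring
    refine ⟨y + √(1 - ‖y‖ ^ 2) • e, ⟨?_, ?_⟩, ?_⟩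
    · rw [← sq_eq_sq₀ (norm_nonneg _) zero_le_one, norm_add_smul_sq he hy, Real.sq_sqrt]
      · ring
      · nlinarith [sq_nonneg c]
    · rw [h3]
      exact Real.le_sqrt_of_sq_le (by linarith)
    · simp only [hP, h3]; abel
  refine (measure_mono hsub).trans ?_
  simpa [surface] using euclideanHausdorffMeasure_image_le hL (n - 1)

/-- The cap is a graph over a disc with Lipschitz constant `c⁻¹`. -/
lemma surface_cap_le (he : ‖e‖ = 1) {c : ℝ} (hc : 0 < c) (hc1 : c ≤ 1) :
    surface n (cap e c) ≤
      ENNReal.ofReal (c⁻¹ ^ (n - 1)) * surface n (disc e (√(1 - c ^ 2))) := by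
  set g : E n → E n := fun y => y + √(1 - ‖y‖ ^ 2) • e with hg
  have hc2 : 0 ≤ 1 - c ^ 2 := by nlinarith
  have hL : LipschitzOnWith (c⁻¹).toNNReal g (disc e (√(1 - c ^ 2))) := by
    refine LipschitzOnWith.of_dist_le_mul ?_
    rintro x ⟨hx, hxr⟩ y ⟨hy, hyr⟩
    rw [Real.coe_toNNReal _ (by positivity), dist_eq_norm, dist_eq_norm]
    have h1 : g x - g y = (x - y) + (√(1 - ‖x‖ ^ 2) - √(1 - ‖y‖ ^ 2)) • e := by
      simp only [hg, sub_smul]; abel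
    have hxr2 : ‖x‖ ^ 2 ≤ 1 - c ^ 2 := by rw [← Real.sq_sqrt hc2]; gcongr
    have hyr2 : ‖y‖ ^ 2 ≤ 1 - c ^ 2 := by rw [← Real.sq_sqrt hc2]; gcongr
    have hsx : √(1 - ‖x‖ ^ 2) ^ 2 = 1 - ‖x‖ ^ 2 := Real.sq_sqrt (by nlinarith [sq_nonneg c])
    have hsy : √(1 - ‖y‖ ^ 2) ^ 2 = 1 - ‖y‖ ^ 2 := Real.sq_sqrt (by nlinarith [sq_nonneg c])
    have hcx : c ≤ √(1 - ‖x‖ ^ 2) := Real.le_sqrt_of_sq_le (by linarith)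
    have hcy : c ≤ √(1 - ‖y‖ ^ 2) := Real.le_sqrt_of_sq_le (by linarith)
    rw [h1, ← sq_le_sq₀ (norm_nonneg _) (by positivity),
      norm_add_smul_sq he (by rw [inner_sub_right, hx, hy, sub_zero]), mul_pow, inv_pow,
      ← div_eq_inv_mul, le_div_iff₀ (by positivity)]
    set a := √(1 - ‖x‖ ^ 2)
    set b := √(1 - ‖y‖ ^ 2)
    set ρ := √(1 - c ^ 2)
    have hρ : ρ ^ 2 = 1 - c ^ 2 := Real.sq_sqrt hc2
    -- `(a - b) (a + b) = |y|² - |x|²`, where `a + b ≥ 2 c` and `|x| + |y| ≤ 2 ρ`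
    have hab : |a - b| * (2 * c) ≤ ‖x - y‖ * (2 * ρ) := by
      calc |a - b| * (2 * c) ≤ |a - b| * (a + b) := by gcongr; linarith
        _ = |(a - b) * (a + b)| := by
            rw [abs_mul, abs_of_nonneg (by linarith : 0 ≤ a + b)]
        _ = |(‖x‖ - ‖y‖) * (‖x‖ + ‖y‖)| := by
            rw [← abs_neg]; congr 1; nlinarith
        _ = |‖x‖ - ‖y‖| * (‖x‖ + ‖y‖) := by
            rw [abs_mul, abs_of_nonneg (by positivity : 0 ≤ ‖x‖ + ‖y‖)]
        _ ≤ ‖x - y‖ * (2 * ρ) := by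
            gcongr
            · exact abs_norm_sub_norm_le x y
            · linarith
    have hab2 : (a - b) ^ 2 * c ^ 2 ≤ ‖x - y‖ ^ 2 * ρ ^ 2 := by
      have h0 : |a - b| * c ≤ ‖x - y‖ * ρ := by linarith
      have := pow_le_pow_left₀ (by positivity) h0 2
      rwa [mul_pow, mul_pow, sq_abs] at this
    rw [hρ] at hab2
    nlinarith
  have hsub : cap e c ⊆ g '' disc e (√(1 - c ^ 2)) := by
    rintro x ⟨hx, hxc⟩
    have hsq := norm_sub_inner_smul_sq he x
    refine ⟨x - ⟪e, x⟫ • e, ⟨?_, ?_⟩, ?_⟩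
    · rw [inner_sub_right, inner_smul_right, real_inner_self_eq_norm_sq, he]; ring
    · apply Real.le_sqrt_of_sq_le
      rw [hsq, hx]
      nlinarith
    · simp only [hg]
      rw [hsq, hx, show 1 - ((1 : ℝ) ^ 2 - ⟪e, x⟫ ^ 2) = ⟪e, x⟫ ^ 2 by ring,
        Real.sqrt_sq (by linarith)]
      abel
  refine (measure_mono hsub).trans ((euclideanHausdorffMeasure_image_le hL (n - 1)).trans ?_)
  rw [ENNReal.ofReal_pow (by positivity)]
  rfl

open scoped Pointwise in
lemma flatCone_subset_Ioo_smul_cap (he : ‖e‖ = 1) {c : ℝ} (hc : 0 < c) (hc1 : c ≤ 1) :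
    flatCone e (√(1 - c ^ 2) / c) c ⊆ Ioo (0 : ℝ) 1 • cap e c := by
  rintro x ⟨⟨h1, h2⟩, h3⟩
  have hc2 : 0 ≤ 1 - c ^ 2 := by nlinarith
  have hsq := norm_sub_inner_smul_sq he x
  have h4 := pow_le_pow_left₀ (norm_nonneg _) h3 2
  rw [hsq, mul_pow, div_pow, Real.sq_sqrt hc2, div_mul_eq_mul_div,
    le_div_iff₀ (by positivity)] at h4
  have h5 : ‖x‖ * c ≤ ⟪e, x⟫ := by
    rw [← sq_le_sq₀ (by positivity) h1.le]
    nlinarith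
  have hx0 : 0 < ‖x‖ := norm_pos_iff.2 (by rintro rfl; simp at h1)
  refine ⟨‖x‖, ⟨hx0, ?_⟩, ‖x‖⁻¹ • x, ⟨?_, ?_⟩, ?_⟩
  · by_contra! h
    nlinarith
  · rw [norm_smul, norm_inv, norm_norm, inv_mul_cancel₀ hx0.ne']
  · rw [inner_smul_right, ← div_eq_inv_mul, le_div_iff₀ hx0]
    linarith
  · exact smul_inv_smul₀ hx0.ne' x

open scoped Pointwise in
lemma Ioo_smul_cap_subset_flatCone (he : ‖e‖ = 1) {c : ℝ} (hc : 0 < c) (hc1 : c ≤ 1) :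
    Ioo (0 : ℝ) 1 • cap e c ⊆ flatCone e (√(1 - c ^ 2) / c) 1 := by
  rintro _ ⟨r, ⟨hr0, hr1⟩, x, ⟨hx, hxc⟩, rfl⟩
  have hc2 : 0 ≤ 1 - c ^ 2 := by nlinarith
  have hx1 : ⟪e, x⟫ ≤ 1 := by
    have := real_inner_le_norm e x
    rwa [he, hx, one_mul] at this
  have hin : ⟪e, r • x⟫ = r * ⟪e, x⟫ := inner_smul_right _ _ _
  refine ⟨⟨?_, ?_⟩, ?_⟩
  · change 0 < ⟪e, r • x⟫
    rw [hin]
    have : 0 < ⟪e, x⟫ := by linarith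
    positivity
  · change ⟪e, r • x⟫ < 1
    rw [hin]; nlinarith
  · change ‖r • x - ⟪e, r • x⟫ • e‖ ≤ _ * ⟪e, r • x⟫
    rw [← sq_le_sq₀ (norm_nonneg _) (by rw [hin]; have : 0 < ⟪e, x⟫ := by linarith
                                        positivity),
      norm_sub_inner_smul_sq he, hin, norm_smul, hx, mul_one, mul_pow, mul_pow, div_pow,
      Real.sq_sqrt hc2, div_mul_eq_mul_div, le_div_iff₀ (by positivity), Real.norm_of_nonneg hr0.le]
    have : c ^ 2 ≤ ⟪e, x⟫ ^ 2 := by gcongr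
    nlinarith [mul_le_mul_of_nonneg_left this (sq_nonneg r)]

/-- The surface measure on the unit sphere coming from polar coordinates, as a measure
on `ℝⁿ`. -/
noncomputable def polarSurface (n : ℕ) : Measure (E n) :=
  (volume : Measure (E n)).toSphere.map Subtype.val

instance : IsFiniteMeasure (polarSurface n) := by
  unfold polarSurface; infer_instance

lemma polarSurface_compl_sphere : polarSurface n (Metric.sphere 0 1)ᶜ = 0 := by
  rw [polarSurface, Measure.map_apply measurable_subtype_coe
    Metric.isClosed_sphere.measurableSet.compl]
  have h : (Subtype.val ⁻¹' (Metric.sphere (0 : E n) 1)ᶜ : Set (Metric.sphere (0 : E n) 1)) =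
      ∅ := by
    ext x
    simp
  rw [h, measure_empty]

lemma cap_subset_sphere (e : E n) (c : ℝ) : cap e c ⊆ Metric.sphere 0 1 := fun x hx => by
  simpa using hx.1

lemma measurableSet_cap (e : E n) (c : ℝ) : MeasurableSet (cap e c) := by
  have h1 : IsClosed {x : E n | ‖x‖ = 1} := isClosed_eq continuous_norm continuous_const
  have h2 : IsClosed {x : E n | c ≤ ⟪e, x⟫} := isClosed_le continuous_const (by fun_prop)
  exact (h1.inter h2).measurableSet

open scoped Pointwise in
lemma polarSurface_cap (e : E n) (c : ℝ) :
    polarSurface n (cap e c) = n * volume (Ioo (0 : ℝ) 1 • cap e c) := by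
  rw [polarSurface, Measure.map_apply measurable_subtype_coe (measurableSet_cap e c),
    Measure.toSphere_apply' _ (measurable_subtype_coe (measurableSet_cap e c)),
    Subtype.image_preimage_coe, inter_eq_self_of_subset_right (cap_subset_sphere e c),
    finrank_euclideanSpace_fin]

lemma natCast_mul_volume_flatCone (hn : 1 ≤ n) (he : ‖e‖ = 1) {c b : ℝ} (hc : 0 < c) (hc1 : c < 1)
    (hb : 0 < b) :
    n * volume (flatCone e (√(1 - c ^ 2) / c) b) =
      ENNReal.ofReal (b ^ n * c⁻¹ ^ (n - 1)) * surface n (disc e (√(1 - c ^ 2))) := by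
  have hρ : 0 < √(1 - c ^ 2) := Real.sqrt_pos.2 (by nlinarith)
  rw [volume_flatCone hn he (by positivity) hb, surface_disc e hρ, ← ENNReal.ofReal_natCast,
    ← mul_assoc, ← mul_assoc, ← ENNReal.ofReal_mul (by positivity),
    ← ENNReal.ofReal_mul (by positivity)]
  congr 2
  have : (n : ℝ) ≠ 0 := by positivity
  rw [div_pow, inv_pow]
  field_simp

lemma polarSurface_cap_le (hn : 1 ≤ n) (he : ‖e‖ = 1) {c : ℝ} (hc : 0 < c) (hc1 : c < 1) :
    polarSurface n (cap e c) ≤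
      ENNReal.ofReal (c⁻¹ ^ (n - 1)) * surface n (disc e (√(1 - c ^ 2))) := by
  rw [polarSurface_cap]
  refine (mul_le_mul_right (measure_mono (Ioo_smul_cap_subset_flatCone he hc hc1.le)) _).trans ?_
  rw [natCast_mul_volume_flatCone hn he hc hc1 one_pos, one_pow, one_mul]

lemma le_polarSurface_cap (hn : 1 ≤ n) (he : ‖e‖ = 1) {c : ℝ} (hc : 0 < c) (hc1 : c < 1) :
    ENNReal.ofReal c * surface n (disc e (√(1 - c ^ 2))) ≤ polarSurface n (cap e c) := by
  rw [polarSurface_cap]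
  refine le_trans ?_
    (mul_le_mul_right (measure_mono (flatCone_subset_Ioo_smul_cap he hc hc1.le)) _)
  rw [natCast_mul_volume_flatCone hn he hc hc1 hc]
  apply le_of_eq
  congr 2
  obtain ⟨m, rfl⟩ : ∃ m, n = m + 1 := ⟨n - 1, by omega⟩
  rw [Nat.add_sub_cancel, pow_succ, inv_pow]
  field_simp

end CapBounds

/-! ### Hausdorff measure on the unit sphere -/

section SurfaceMeasure

/-- Two finite measures on `ℝⁿ`, both concentrated on `S`, agree if the measures of small balls
centered in `S` are asymptotically equal. This is differentiation of measures along balls. -/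
lemma measure_eq_of_tendsto_closedBall {n : ℕ} {ρ μ : Measure (E n)} [IsFiniteMeasure ρ]
    [IsFiniteMeasure μ] {S : Set (E n)} (hρ : ρ Sᶜ = 0) (hμ : μ Sᶜ = 0)
    (h : ∀ x ∈ S, Filter.Tendsto
      (fun r => ρ (Metric.closedBall x r) / μ (Metric.closedBall x r)) (𝓝[>] 0) (𝓝 1))
    (h' : ∀ x ∈ S, Filter.Tendsto
      (fun r => μ (Metric.closedBall x r) / ρ (Metric.closedBall x r)) (𝓝[>] 0) (𝓝 1)) :
    ρ = μ := by
  have aux : ∀ {ρ μ : Measure (E n)} [IsFiniteMeasure ρ] [IsFiniteMeasure μ], μ Sᶜ = 0 →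
      (∀ x ∈ S, Filter.Tendsto
        (fun r => ρ (Metric.closedBall x r) / μ (Metric.closedBall x r)) (𝓝[>] 0) (𝓝 1)) →
      μ ≤ ρ := by
    intro ρ μ _ _ hμ h
    have h1 : ρ.rnDeriv μ =ᵐ[μ] 1 := by
      filter_upwards [Besicovitch.ae_tendsto_rnDeriv ρ μ, compl_mem_ae_iff.2 hμ] with x hx hxS
      rw [compl_compl] at hxS
      exact tendsto_nhds_unique hx (h x hxS)
    calc μ = μ.withDensity (ρ.rnDeriv μ) := by rw [withDensity_congr_ae h1, withDensity_one]
      _ ≤ ρ := Measure.withDensity_rnDeriv_le ρ μ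
  exact le_antisymm (aux hρ h') (aux hμ h)

lemma tendsto_div_of_le_mul {A B K : ℝ → ℝ≥0∞} {l : Filter ℝ} (hK : Filter.Tendsto K l (𝓝 1))
    (hAB : ∀ᶠ r in l, A r ≤ K r * B r) (hBA : ∀ᶠ r in l, B r ≤ K r * A r)
    (h0 : ∀ᶠ r in l, B r ≠ 0) (ht : ∀ᶠ r in l, B r ≠ ⊤) :
    Filter.Tendsto (fun r => A r / B r) l (𝓝 1) := by
  have hKi : Filter.Tendsto (fun r => (K r)⁻¹) l (𝓝 1) := by
    simpa using tendsto_inv_iff.2 hK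
  refine tendsto_of_tendsto_of_tendsto_of_le_of_le' hKi hK ?_ ?_
  · filter_upwards [hBA, h0, ht] with r h1 h2 h3
    rw [ENNReal.le_div_iff_mul_le (Or.inl h2) (Or.inl h3), mul_comm, ← div_eq_mul_inv]
    exact ENNReal.div_le_of_le_mul (by rwa [mul_comm])
  · filter_upwards [hAB] with r h1
    exact ENNReal.div_le_of_le_mul h1

variable {n : ℕ} {e : E n}

lemma closedBall_inter_sphere (he : ‖e‖ = 1) {r : ℝ} (hr : 0 ≤ r) :
    Metric.closedBall e r ∩ Metric.sphere 0 1 = cap e (1 - r ^ 2 / 2) := by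
  ext x
  simp only [cap, mem_inter_iff, Metric.mem_closedBall, mem_sphere_iff_norm, sub_zero,
    mem_ofPred_eq, dist_eq_norm]
  rw [and_comm]
  refine and_congr_right fun hx => ?_
  rw [← sq_le_sq₀ (norm_nonneg _) hr, norm_sub_sq_real, hx, he, real_inner_comm]
  constructor <;> intro h <;> linarith

/-- Cap and cone over it are compared with the disc of the same radius: the two surface measures of
the cap `{⟨e, x⟩ ≥ c}` differ by a factor of at most `c⁻ⁿ`. -/
lemma cap_estimates (hn : 1 ≤ n) (he : ‖e‖ = 1) {c : ℝ} (hc : 0 < c) (hc1 : c < 1) :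
    (surface n (cap e c) ≠ 0 ∧ surface n (cap e c) ≠ ⊤) ∧
    (polarSurface n (cap e c) ≠ 0 ∧ polarSurface n (cap e c) ≠ ⊤) ∧
    surface n (cap e c) ≤ ENNReal.ofReal (c⁻¹ ^ n) * polarSurface n (cap e c) ∧
    polarSurface n (cap e c) ≤ ENNReal.ofReal (c⁻¹ ^ n) * surface n (cap e c) := by
  have hρ : 0 < √(1 - c ^ 2) := Real.sqrt_pos.2 (by nlinarith)
  set d := surface n (disc e (√(1 - c ^ 2))) with hd
  have hd0 : d ≠ 0 := by
    rw [hd, surface_disc e hρ]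
    exact mul_ne_zero (ENNReal.ofReal_pos.2 (by positivity)).ne' (surface_disc_one_pos he).ne'
  have hdt : d ≠ ⊤ := by
    rw [hd, surface_disc e hρ]
    exact ENNReal.mul_ne_top ENNReal.ofReal_ne_top (surface_disc_one_lt_top he).ne
  have hA1 := surface_disc_le_surface_cap he hc.le hc1.le
  have hA2 := surface_cap_le he hc hc1.le
  have hB1 := le_polarSurface_cap hn he hc hc1
  have hB2 := polarSurface_cap_le hn he hc hc1
  rw [← hd] at hA1 hA2 hB1 hB2
  have hcd : ENNReal.ofReal c⁻¹ * ENNReal.ofReal c = 1 := by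
    rw [← ENNReal.ofReal_mul (by positivity), inv_mul_cancel₀ hc.ne', ENNReal.ofReal_one]
  have hpow : ENNReal.ofReal (c⁻¹ ^ n) = ENNReal.ofReal (c⁻¹ ^ (n - 1)) * ENNReal.ofReal c⁻¹ := by
    rw [← ENNReal.ofReal_mul (by positivity), ← pow_succ]
    congr 2; omega
  have hc' : 1 ≤ ENNReal.ofReal c⁻¹ := by
    rw [ENNReal.one_le_ofReal]; exact (one_le_inv₀ hc).2 hc1.le
  have hdB : d ≤ ENNReal.ofReal c⁻¹ * polarSurface n (cap e c) := by
    calc d = ENNReal.ofReal c⁻¹ * (ENNReal.ofReal c * d) := by rw [← mul_assoc, hcd, one_mul]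
      _ ≤ _ := by gcongr
  refine ⟨⟨?_, ?_⟩, ⟨?_, ?_⟩, ?_, ?_⟩
  · exact fun h => hd0 (le_zero_iff.1 (h ▸ hA1))
  · exact (hA2.trans_lt (ENNReal.mul_lt_top ENNReal.ofReal_lt_top hdt.lt_top)).ne
  · intro h
    rw [h, mul_zero] at hdB
    exact hd0 (le_zero_iff.1 hdB)
  · exact measure_ne_top _ _
  · calc _ ≤ _ := hA2
      _ ≤ ENNReal.ofReal (c⁻¹ ^ (n - 1)) * (ENNReal.ofReal c⁻¹ * polarSurface n (cap e c)) := by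
        gcongr
      _ = _ := by rw [hpow, mul_assoc]
  · calc _ ≤ _ := hB2
      _ ≤ ENNReal.ofReal (c⁻¹ ^ (n - 1)) * surface n (cap e c) := by gcongr
      _ = ENNReal.ofReal (c⁻¹ ^ (n - 1)) * 1 * surface n (cap e c) := by rw [mul_one]
      _ ≤ _ := by rw [hpow]; gcongr

lemma isFiniteMeasure_surface_sphere (hn : 1 ≤ n) :
    IsFiniteMeasure ((surface n).restrict (Metric.sphere (0 : E n) 1)) := by
  refine ⟨?_⟩
  rw [Measure.restrict_apply_univ]
  refine (isCompact_sphere (0 : E n) 1).measure_lt_top_of_nhdsWithin fun x hx => ?_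
  have he : ‖x‖ = 1 := by simpa using hx
  refine ⟨cap x (1 - 1 ^ 2 / 2), ?_, ?_⟩
  · rw [← closedBall_inter_sphere he zero_le_one, inter_comm]
    exact inter_mem_nhdsWithin _ (Metric.closedBall_mem_nhds _ one_pos)
  · exact (cap_estimates hn he (by norm_num) (by norm_num)).1.2.lt_top

/-- On the unit sphere, Hausdorff measure is the measure of polar coordinates. -/
lemma surface_restrict_sphere (hn : 1 ≤ n) :
    (surface n).restrict (Metric.sphere (0 : E n) 1) = polarSurface n := by
  have := isFiniteMeasure_surface_sphere hn
  have hms : MeasurableSet (Metric.sphere (0 : E n) 1) := Metric.isClosed_sphere.measurableSet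
  have h0 : (surface n).restrict (Metric.sphere (0 : E n) 1) (Metric.sphere (0 : E n) 1)ᶜ = 0 := by
    rw [Measure.restrict_apply hms.compl, compl_inter_self, measure_empty]
  have hc : Filter.Tendsto (fun r : ℝ => ENNReal.ofReal ((1 - r ^ 2 / 2)⁻¹ ^ n)) (𝓝[>] 0)
      (𝓝 1) := by
    have h1 : ContinuousAt (fun r : ℝ => (1 - r ^ 2 / 2)⁻¹ ^ n) 0 := by
      refine ContinuousAt.pow (ContinuousAt.inv₀ (by fun_prop) (by norm_num)) n
    have h2 := (ENNReal.continuous_ofReal.continuousAt.comp h1).tendsto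
    simp only [Function.comp_def] at h2
    refine (tendsto_nhdsWithin_of_tendsto_nhds h2).trans ?_
    simp
  have hball : ∀ x ∈ Metric.sphere (0 : E n) 1, ∀ r : ℝ, 0 ≤ r →
      (surface n).restrict (Metric.sphere (0 : E n) 1) (Metric.closedBall x r) =
        surface n (cap x (1 - r ^ 2 / 2)) ∧
      polarSurface n (Metric.closedBall x r) = polarSurface n (cap x (1 - r ^ 2 / 2)) := by
    intro x hx r hr
    rw [← closedBall_inter_sphere (by simpa using hx) hr]
    refine ⟨Measure.restrict_apply Metric.isClosed_closedBall.measurableSet, ?_⟩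
    exact (measure_inter_conull polarSurface_compl_sphere).symm
  have hev : ∀ᶠ r : ℝ in 𝓝[>] 0, 0 < r ∧ r < 1 := Ioo_mem_nhdsGT one_pos
  refine measure_eq_of_tendsto_closedBall h0 polarSurface_compl_sphere ?_ ?_
  all_goals
    intro x hx
    have hest : ∀ r : ℝ, 0 < r ∧ r < 1 → _ := fun r hr => cap_estimates hn
      (show ‖x‖ = 1 by simpa using hx) (show 0 < 1 - r ^ 2 / 2 by nlinarith)
      (show 1 - r ^ 2 / 2 < 1 by nlinarith)
    refine tendsto_div_of_le_mul hc ?_ ?_ ?_ ?_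
    all_goals
      filter_upwards [hev] with r hr
      obtain ⟨⟨h1, h2⟩, ⟨h3, h4⟩, h5, h6⟩ := hest r hr
      obtain ⟨h7, h8⟩ := hball x hx r hr.1.le
      simp only [h7, h8]
      assumption

end SurfaceMeasure

/-! ### Polar coordinates -/

section PolarCoordinates

variable {n : ℕ}

/-- Polar coordinates in the unit ball. -/
lemma integral_ball_eq_integral_sphere (hn : 1 ≤ n) {g : E n → ℝ} (hg : Continuous g) :
    ∫ x in Metric.ball (0 : E n) 1, g x =
      ∫ w : Metric.sphere (0 : E n) 1, (∫ r in (0 : ℝ)..1, r ^ (n - 1) * g (r • (w : E n)))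
        ∂(volume : Measure (E n)).toSphere := by
  have : Nontrivial (E n) := by
    have : Nonempty (Fin n) := ⟨⟨0, hn⟩⟩
    infer_instance
  set G : E n → ℝ := (Metric.ball (0 : E n) 1).indicator g with hG
  have hGi : Integrable G := by
    rw [hG, integrable_indicator_iff Metric.isOpen_ball.measurableSet]
    exact (hg.continuousOn.integrableOn_compact (isCompact_closedBall 0 1)).mono_set
      Metric.ball_subset_closedBall
  have hmp := (volume : Measure (E n)).measurePreserving_homeomorphUnitSphereProd
  have hemb := (homeomorphUnitSphereProd (E n)).measurableEmbedding
  rw [finrank_euclideanSpace_fin] at hmp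
  set H : Metric.sphere (0 : E n) 1 × Ioi (0 : ℝ) → ℝ :=
    fun p => G ((p.2 : ℝ) • (p.1 : E n)) with hH
  have hHG : ∀ x : ({0}ᶜ : Set (E n)), H (homeomorphUnitSphereProd (E n) x) = G x := by
    intro x
    rw [hH]
    simp only
    rw [← homeomorphUnitSphereProd_symm_apply_coe, Homeomorph.symm_apply_apply]
  have h0 : MeasurableSet ({0}ᶜ : Set (E n)) := (measurableSet_singleton _).compl
  have hHi : Integrable H ((volume : Measure (E n)).toSphere.prod (.volumeIoiPow (n - 1))) := by
    rw [← hmp.integrable_comp_emb hemb]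
    have h1 : H ∘ homeomorphUnitSphereProd (E n) = G ∘ Subtype.val := funext hHG
    rw [h1, ← integrableOn_iff_comap_subtypeVal h0]
    exact hGi.integrableOn
  rw [← integral_indicator Metric.isOpen_ball.measurableSet, ← hG]
  calc ∫ x, G x = ∫ x : ({0}ᶜ : Set (E n)), G (x : E n)
          ∂((volume : Measure (E n)).comap Subtype.val) := by
        rw [integral_subtype_comap h0 G, restrict_compl_singleton]
    _ = ∫ p, H p ∂((volume : Measure (E n)).toSphere.prod (.volumeIoiPow (n - 1))) := by
        rw [← hmp.integral_comp hemb H]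
        exact integral_congr_ae (.of_forall fun x => (hHG x).symm)
    _ = _ := by
        rw [integral_prod _ hHi]
        refine integral_congr_ae (.of_forall fun w => ?_)
        simp only [hH, Measure.volumeIoiPow, ENNReal.ofReal]
        rw [integral_withDensity_eq_integral_smul
            (measurable_subtype_coe.pow_const _).real_toNNReal,
          integral_subtype_comap measurableSet_Ioi
            (fun r : ℝ => Real.toNNReal (r ^ (n - 1)) • G (r • (w : E n))),
          intervalIntegral.integral_of_le zero_le_one, integral_Ioc_eq_integral_Ioo]
        have hw : ‖(w : E n)‖ = 1 := by simp
        rw [← Ioi_inter_Iio (a := (0 : ℝ)), ← setIntegral_indicator measurableSet_Iio]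
        refine setIntegral_congr_fun measurableSet_Ioi fun r hr => ?_
        have hr' : 0 < r := hr
        simp only [hG, indicator, Metric.mem_ball, dist_zero_right, norm_smul, hw, mul_one,
          Real.norm_of_nonneg hr'.le, mem_Iio, NNReal.smul_def,
          Real.coe_toNNReal _ (pow_nonneg hr'.le _), smul_eq_mul]
        split_ifs <;> simp

lemma integral_polarSurface (f : E n → ℝ) :
    ∫ w : Metric.sphere (0 : E n) 1, f w ∂(volume : Measure (E n)).toSphere =
      ∫ x, f x ∂(polarSurface n) := by
  rw [polarSurface,
    (MeasurableEmbedding.subtype_coe Metric.isClosed_sphere.measurableSet).integral_map]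

/-- The divergence theorem in the unit ball for a radial field `x ↦ f(x) x`: along each ray
`rⁿ f(r ω)` is a primitive of `rⁿ⁻¹ div (f x)`. -/
lemma integral_ball_radial (hn : 1 ≤ n) {f : E n → ℝ} (hf : ContDiff ℝ 1 f) :
    ∫ x in Metric.ball (0 : E n) 1, (n * f x + fderiv ℝ f x x) = ∫ x, f x ∂(polarSurface n) := by
  have hfd : Continuous (fderiv ℝ f) := hf.continuous_fderiv (by simp)
  have hc : Continuous fun x => n * f x + fderiv ℝ f x x :=
    (continuous_const.mul hf.continuous).add (hfd.clm_apply continuous_id)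
  rw [integral_ball_eq_integral_sphere hn hc, ← integral_polarSurface]
  refine integral_congr_ae (.of_forall fun w => ?_)
  have hder : ∀ r : ℝ, HasDerivAt (fun r : ℝ => r ^ n * f (r • (w : E n)))
      (r ^ (n - 1) * (n * f (r • (w : E n)) + fderiv ℝ f (r • (w : E n)) (r • (w : E n)))) r := by
    intro r
    have h1 : HasDerivAt (fun r : ℝ => r • (w : E n)) (w : E n) r := by
      simpa using (hasDerivAt_id r).smul_const (w : E n)
    have h2 : HasDerivAt (fun r : ℝ => f (r • (w : E n))) (fderiv ℝ f (r • (w : E n)) w) r :=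
      ((hf.differentiable (by simp)).differentiableAt.hasFDerivAt).comp_hasDerivAt r h1
    refine ((hasDerivAt_pow n r).mul h2).congr_deriv ?_
    obtain ⟨m, rfl⟩ : ∃ m, n = m + 1 := ⟨n - 1, by omega⟩
    rw [map_smul, smul_eq_mul, Nat.add_sub_cancel]
    push_cast
    ring
  refine (intervalIntegral.integral_eq_sub_of_hasDerivAt (fun r _ => hder r) ?_).trans ?_
  · apply Continuous.intervalIntegrable
    have := hf.continuous
    fun_prop
  · simp [show n ≠ 0 by omega]

end PolarCoordinates

/-! ### The divergence theorem in the unit ball -/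

section Divergence

variable {n : ℕ}

lemma integral_fderiv_eq_zero {h : E n → ℝ} (hh : ContDiff ℝ 1 h) (hc : HasCompactSupport h)
    (v : E n) : ∫ x, fderiv ℝ h x v = 0 := by
  have hd : Continuous fun x => fderiv ℝ h x v :=
    (hh.continuous_fderiv (by simp)).clm_apply continuous_const
  have hdc : HasCompactSupport fun x => fderiv ℝ h x v := hc.fderiv_apply ℝ v
  have key := integral_mul_fderiv_eq_neg_fderiv_mul_of_integrable (f := h) (g := fun _ => (1 : ℝ))
    (v := v) (μ := volume) ?_ ?_ ?_ ?_ ?_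
  · simpa using key.symm
  · simpa using hd.integrable_of_hasCompactSupport hdc
  · simp
  · simpa using hh.continuous.integrable_of_hasCompactSupport hc
  · exact fun x _ => (hh.differentiable (by simp)).differentiableAt
  · exact fun x _ => differentiableAt_const _

lemma fderiv_coord {F : E n → E n} {x : E n} (hF : DifferentiableAt ℝ F x) (i : Fin n) (v : E n) :
    fderiv ℝ (fun y => F y i) x v = (fderiv ℝ F x v) i := by
  have := ((EuclideanSpace.proj i : E n →L[ℝ] ℝ).hasFDerivAt.comp x hF.hasFDerivAt)
  have h2 : HasFDerivAt (fun y => F y i)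
      ((EuclideanSpace.proj i : E n →L[ℝ] ℝ).comp (fderiv ℝ F x)) x := this
  rw [h2.fderiv]
  rfl

lemma contDiff_coord {k : WithTop ℕ∞} {F : E n → E n} (hF : ContDiff ℝ k F) (i : Fin n) :
    ContDiff ℝ k fun x => F x i :=
  (EuclideanSpace.proj i : E n →L[ℝ] ℝ).contDiff.comp hF

lemma integral_divergence_eq_zero {F : E n → E n} (hF : ContDiff ℝ 1 F)
    (hc : HasCompactSupport F) : ∫ x, divergence F x = 0 := by
  have hcoord : ∀ i, HasCompactSupport fun x => F x i := fun i =>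
    hc.comp_left (g := fun y : E n => y i) (by simp)
  have h1 : ∀ x, divergence F x =
      ∑ i, fderiv ℝ (fun y => F y i) x (EuclideanSpace.single i 1) := fun x =>
    Finset.sum_congr rfl fun i _ =>
      (fderiv_coord (hF.differentiable (by simp)).differentiableAt i _).symm
  simp_rw [h1]
  rw [integral_finsetSum]
  · exact Finset.sum_eq_zero fun i _ => integral_fderiv_eq_zero (contDiff_coord hF i) (hcoord i) _
  · intro i _
    exact (((contDiff_coord hF i).continuous_fderiv (by simp)).clm_apply
      continuous_const).integrable_of_hasCompactSupport ((hcoord i).fderiv_apply ℝ _)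

lemma sum_apply_mul {L : E n →L[ℝ] ℝ} (y : E n) :
    ∑ i, L (EuclideanSpace.single i 1) * y i = L y := by
  conv_rhs => rw [← (EuclideanSpace.basisFun (Fin n) ℝ).sum_repr y]
  simp [mul_comm]

lemma divergence_smul {η : E n → ℝ} {F : E n → E n} {x : E n} (hη : DifferentiableAt ℝ η x)
    (hF : DifferentiableAt ℝ F x) :
    divergence (fun y => η y • F y) x = η x * divergence F x + fderiv ℝ η x (F x) := by
  have h : HasFDerivAt (fun y => η y • F y)
      (η x • fderiv ℝ F x + (fderiv ℝ η x).smulRight (F x)) x :=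
    hη.hasFDerivAt.smul hF.hasFDerivAt
  unfold divergence
  rw [h.fderiv]
  simp only [add_apply, smul_apply,
    ContinuousLinearMap.smulRight_apply, PiLp.add_apply, PiLp.smul_apply, smul_eq_mul,
    Finset.sum_add_distrib, Finset.mul_sum, sum_apply_mul]

lemma divergence_id (x : E n) : divergence (fun y : E n => y) x = n := by
  simp [divergence]

lemma divergence_add {F G : E n → E n} {x : E n} (hF : DifferentiableAt ℝ F x)
    (hG : DifferentiableAt ℝ G x) :
    divergence (fun y => F y + G y) x = divergence F x + divergence G x := by
  unfold divergence
  rw [fderiv_fun_add hF hG]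
  simp [Finset.sum_add_distrib]

lemma continuous_divergence {F : E n → E n} (hF : ContDiff ℝ 1 F) : Continuous (divergence F) := by
  unfold divergence
  refine continuous_finsetSum _ fun i _ => ?_
  exact (EuclideanSpace.proj i : E n →L[ℝ] ℝ).continuous.comp
    ((hF.continuous_fderiv (by simp)).clm_apply continuous_const)

lemma hasDerivAt_posPart_sq (t : ℝ) :
    HasDerivAt (fun t : ℝ => (max 0 t) ^ 2) (2 * max 0 t) t := by
  rcases lt_trichotomy t 0 with h | rfl | h
  · rw [max_eq_left h.le, mul_zero]
    refine (hasDerivAt_const t (0 : ℝ)).congr_of_eventuallyEq ?_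
    filter_upwards [gt_mem_nhds h] with s hs
    rw [max_eq_left hs.le]; norm_num
  · rw [max_self, mul_zero, hasDerivAt_iff_isLittleO_nhds_zero]
    have h1 : (fun h : ℝ => h ^ 2) =o[𝓝 0] fun h => h := by
      simpa using Asymptotics.isLittleO_pow_id (𝕜 := ℝ) (n := 2) (by norm_num)
    refine Asymptotics.IsBigO.trans_isLittleO ?_ h1
    refine Asymptotics.IsBigO.of_bound 1 (.of_forall fun s => ?_)
    simp only [zero_add, max_self, smul_eq_mul, mul_zero, sub_zero, one_mul, norm_pow,
      Real.norm_eq_abs, sq_abs]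
    rcases le_total s 0 with h | h
    · rw [max_eq_left h]
      norm_num
      positivity
    · rw [max_eq_right h]; norm_num
  · rw [max_eq_right h.le]
    have : HasDerivAt (fun t : ℝ => t ^ 2) (2 * t) t := by simpa using hasDerivAt_pow 2 t
    refine this.congr_of_eventuallyEq ?_
    filter_upwards [lt_mem_nhds h] with s hs
    rw [max_eq_right hs.le]

/-- A `C¹` cutoff function of the unit ball; these increase to `1` in the open ball as
`k → ∞`. -/
noncomputable def ballCutoff (k : ℕ) (x : E n) : ℝ := (max 0 (1 - (‖x‖ ^ 2) ^ (k + 1))) ^ 2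

lemma hasFDerivAt_ballCutoff (k : ℕ) (x : E n) :
    HasFDerivAt (ballCutoff k) ((-(4 * (k + 1) * (‖x‖ ^ 2) ^ k *
      max 0 (1 - (‖x‖ ^ 2) ^ (k + 1)))) • innerSL ℝ x) x := by
  have h1 : HasFDerivAt (fun x : E n => ‖x‖ ^ 2) (2 • innerSL ℝ x) x :=
    (hasStrictFDerivAt_norm_sq x).hasFDerivAt
  have h2 : HasDerivAt (fun s : ℝ => 1 - s ^ (k + 1)) (-((k + 1) * (‖x‖ ^ 2) ^ k)) (‖x‖ ^ 2) := by
    simpa using (hasDerivAt_pow (k + 1) (‖x‖ ^ 2)).const_sub 1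
  have h3 := ((hasDerivAt_posPart_sq (1 - (‖x‖ ^ 2) ^ (k + 1))).comp (‖x‖ ^ 2) h2).comp_hasFDerivAt
    x h1
  refine h3.congr_fderiv ?_
  ext v
  simp
  ring

lemma contDiff_ballCutoff (k : ℕ) : ContDiff ℝ 1 (ballCutoff (n := n) k) := by
  rw [contDiff_one_iff_hasFDerivAt]
  refine ⟨_, ?_, fun x => hasFDerivAt_ballCutoff k x⟩
  fun_prop

lemma ballCutoff_eq_zero (k : ℕ) {x : E n} (hx : 1 ≤ ‖x‖) : ballCutoff k x = 0 := by
  have : 1 ≤ (‖x‖ ^ 2) ^ (k + 1) := one_le_pow₀ (one_le_pow₀ hx)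
  rw [ballCutoff, max_eq_left (by linarith)]
  norm_num

lemma hasCompactSupport_ballCutoff (k : ℕ) : HasCompactSupport (ballCutoff (n := n) k) := by
  refine HasCompactSupport.intro (isCompact_closedBall 0 1) fun x hx => ballCutoff_eq_zero k ?_
  simp only [Metric.mem_closedBall, dist_zero_right, not_le] at hx
  exact hx.le

/-- A field that is tangential on the unit sphere has mean divergence zero in the ball. The boundary
layer of the cutoff contributes `(k+1) |x|^{2k} (1 - |x|²) f(x)`, which is bounded and tends
to `0`. -/
lemma integral_ball_divergence_of_tangential {G : E n → E n} (hG : ContDiff ℝ 1 G) {f : E n → ℝ}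
    (hf : Continuous f) (hGf : ∀ x, ⟪x, G x⟫ = (1 - ‖x‖ ^ 2) * f x) :
    ∫ x in Metric.ball (0 : E n) 1, divergence G x = 0 := by
  set I : ℕ → E n → ℝ := fun k x => ballCutoff k x * divergence G x -
    4 * ((k + 1) * (‖x‖ ^ 2) ^ k * (1 - ‖x‖ ^ 2)) * (1 - (‖x‖ ^ 2) ^ (k + 1)) * f x with hI
  have hdG := continuous_divergence hG
  have hzero : ∀ k, ∫ x in Metric.ball (0 : E n) 1, I k x = 0 := by
    intro k
    have h1 : ∫ x, divergence (fun y => ballCutoff k y • G y) x = 0 :=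
      integral_divergence_eq_zero ((contDiff_ballCutoff k).smul hG)
        ((hasCompactSupport_ballCutoff k).smul_right (f' := G))
    have h2 : ∀ x, divergence (fun y => ballCutoff k y • G y) x =
        (Metric.ball (0 : E n) 1).indicator (I k) x := by
      intro x
      have h3 : divergence (fun y => ballCutoff k y • G y) x = ballCutoff k x * divergence G x +
          fderiv ℝ (ballCutoff k) x (G x) :=
        divergence_smul (hasFDerivAt_ballCutoff k x).differentiableAt
          (hG.differentiable (by simp)).differentiableAt
      rw [h3, (hasFDerivAt_ballCutoff k x).fderiv, smul_apply,
        innerSL_apply_apply, hGf, smul_eq_mul]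
      by_cases hx : ‖x‖ < 1
      · rw [indicator_of_mem (by simpa using hx), hI]
        have : (‖x‖ ^ 2) ^ (k + 1) ≤ 1 :=
          pow_le_one₀ (by positivity) (pow_le_one₀ (norm_nonneg _) hx.le)
        rw [max_eq_right (by linarith)]
        ring
      · rw [indicator_of_notMem (by simpa using hx)]
        have : 1 ≤ (‖x‖ ^ 2) ^ (k + 1) := one_le_pow₀ (one_le_pow₀ (not_lt.1 hx))
        rw [ballCutoff_eq_zero k (not_lt.1 hx), max_eq_left (by linarith)]
        ring
    rw [← integral_indicator Metric.isOpen_ball.measurableSet, ← h1]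
    exact integral_congr_ae (.of_forall fun x => (h2 x).symm)
  have hlim : Filter.Tendsto (fun k => ∫ x in Metric.ball (0 : E n) 1, I k x) Filter.atTop
      (𝓝 (∫ x in Metric.ball (0 : E n) 1, divergence G x)) := by
    refine tendsto_integral_of_dominated_convergence
      (fun x => |divergence G x| + 4 * |f x|) (fun k => ?_) ?_ (fun k => ?_) ?_
    · have := (contDiff_ballCutoff (n := n) k).continuous
      exact Continuous.aestronglyMeasurable (by fun_prop)
    · have : Continuous fun x => |divergence G x| + 4 * |f x| := by fun_prop
      exact (this.continuousOn.integrableOn_compact (isCompact_closedBall 0 1)).mono_set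
        Metric.ball_subset_closedBall
    · filter_upwards [ae_restrict_mem Metric.isOpen_ball.measurableSet] with x hx
      have hx1 : ‖x‖ < 1 := by simpa using hx
      set s := ‖x‖ ^ 2 with hs
      have hs0 : 0 ≤ s := by positivity
      have hs1 : s ≤ 1 := pow_le_one₀ (norm_nonneg _) hx1.le
      have hp : 0 ≤ s ^ (k + 1) ∧ s ^ (k + 1) ≤ 1 := ⟨by positivity, pow_le_one₀ hs0 hs1⟩
      have hη : 0 ≤ ballCutoff k x ∧ ballCutoff k x ≤ 1 := by
        rw [ballCutoff, max_eq_right (by linarith [hp.2])]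
        constructor
        · positivity
        · exact pow_le_one₀ (by linarith [hp.2]) (by linarith [hp.1])
      -- `(k+1) s^k (1-s) ≤ (1 + s + ⋯ + s^k) (1-s) = 1 - s^(k+1)`
      have hb : (k + 1) * s ^ k * (1 - s) ≤ 1 := by
        have h1 : ((k : ℝ) + 1) * s ^ k ≤ ∑ i ∈ Finset.range (k + 1), s ^ i := by
          have := Finset.card_nsmul_le_sum (Finset.range (k + 1)) (fun i => s ^ i) (s ^ k)
            fun i hi => pow_le_pow_of_le_one hs0 hs1 (by
              have := Finset.mem_range.1 hi; omega)
          simpa using this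
        have h2 := mul_le_mul_of_nonneg_right h1 (by linarith : 0 ≤ 1 - s)
        have h3 := geom_sum_mul_neg s (k + 1)
        linarith [hp.1]
      have hb0 : 0 ≤ (k + 1) * s ^ k * (1 - s) :=
        mul_nonneg (by positivity) (by linarith)
      have h4 : (k + 1) * s ^ k * (1 - s) * (1 - s ^ (k + 1)) ≤ 1 :=
        mul_le_one₀ hb (by linarith [hp.2]) (by linarith [hp.1])
      have h5 : 0 ≤ (k + 1) * s ^ k * (1 - s) * (1 - s ^ (k + 1)) :=
        mul_nonneg hb0 (by linarith [hp.2])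
      calc ‖I k x‖ ≤ ‖ballCutoff k x * divergence G x‖ +
            ‖4 * ((k + 1) * s ^ k * (1 - s)) * (1 - s ^ (k + 1)) * f x‖ := norm_sub_le _ _
        _ = ballCutoff k x * |divergence G x| +
            4 * ((k + 1) * s ^ k * (1 - s) * (1 - s ^ (k + 1))) * |f x| := by
          rw [norm_mul (ballCutoff k x), norm_mul _ (f x), mul_assoc 4, Real.norm_of_nonneg hη.1,
            Real.norm_of_nonneg (mul_nonneg zero_le_four h5), Real.norm_eq_abs, Real.norm_eq_abs]
        _ ≤ 1 * |divergence G x| + 4 * 1 * |f x| := by gcongr; exact hη.2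
        _ = _ := by ring
    · filter_upwards [ae_restrict_mem Metric.isOpen_ball.measurableSet] with x hx
      have hx1 : ‖x‖ < 1 := by simpa using hx
      have hs1 : ‖x‖ ^ 2 < 1 := pow_lt_one₀ (norm_nonneg _) hx1 two_ne_zero
      have hs0 : 0 ≤ ‖x‖ ^ 2 := by positivity
      have hp : Filter.Tendsto (fun k : ℕ => (‖x‖ ^ 2) ^ (k + 1)) Filter.atTop (𝓝 0) :=
        (tendsto_pow_atTop_nhds_zero_of_lt_one hs0 hs1).comp (Filter.tendsto_add_atTop_nat 1)
      have hq : Filter.Tendsto (fun k : ℕ => ((k : ℝ) + 1) * (‖x‖ ^ 2) ^ k) Filter.atTop (𝓝 0) := by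
        have h1 := tendsto_self_mul_const_pow_of_lt_one hs0 hs1
        have h2 := tendsto_pow_atTop_nhds_zero_of_lt_one hs0 hs1
        simpa [add_mul] using h1.add h2
      have hη : Filter.Tendsto (fun k : ℕ => ballCutoff k x) Filter.atTop (𝓝 1) := by
        have h1 : Filter.Tendsto (fun k : ℕ => (max 0 (1 - (‖x‖ ^ 2) ^ (k + 1))) ^ 2)
            Filter.atTop (𝓝 ((max 0 (1 - 0)) ^ 2)) :=
          ((tendsto_const_nhds.max (tendsto_const_nhds.sub hp))).pow 2
        simpa [ballCutoff] using h1
      have := (hη.mul_const (divergence G x)).sub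
        ((((hq.mul_const (1 - ‖x‖ ^ 2)).const_mul 4).mul
          (tendsto_const_nhds (x := (1 : ℝ)).sub hp)).mul_const (f x))
      simpa [hI] using this
  simp_rw [hzero] at hlim
  exact tendsto_nhds_unique hlim tendsto_const_nhds

lemma frontier_unitBall :
    frontier (Metric.ball (0 : E n) 1) = Metric.sphere 0 1 :=
  frontier_ball 0 one_ne_zero

/-- The divergence theorem in the unit ball. The field is split into its radial part `⟨F, x⟩ x` and
a field that is tangential on the sphere. -/
theorem integral_ball_divergence (hn : 1 ≤ n) {F : E n → E n} (hF : ContDiff ℝ 1 F) :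
    ∫ x in Metric.ball (0 : E n) 1, divergence F x =
      ∫ x in Metric.sphere (0 : E n) 1, ⟪F x, x⟫ ∂(surface n) := by
  have hf : ContDiff ℝ 1 fun x => ⟪F x, x⟫ := hF.inner ℝ contDiff_id
  set f : E n → ℝ := fun x => ⟪F x, x⟫ with hfdef
  have hR : ContDiff ℝ 1 fun x => f x • x := hf.smul contDiff_id
  have hG : ContDiff ℝ 1 fun x => F x - f x • x := hF.sub hR
  have h1 := integral_ball_divergence_of_tangential hG hf.continuous (fun x => by
    rw [inner_sub_right, inner_smul_right, real_inner_self_eq_norm_sq, real_inner_comm]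
    simp only [hfdef]
    ring)
  have hd : ∀ x, divergence F x =
      divergence (fun x => F x - f x • x) x + (n * f x + fderiv ℝ f x x) := by
    intro x
    have h2 : divergence (fun y => f y • y) x = n * f x + fderiv ℝ f x x := by
      rw [divergence_smul (hf.differentiable (by simp)).differentiableAt differentiableAt_fun_id,
        divergence_id]
      ring
    rw [← h2, ← divergence_add (hG.differentiable (by simp)).differentiableAt
      (hR.differentiable (by simp)).differentiableAt]
    simp
  have hfd : Continuous fun x => n * f x + fderiv ℝ f x x :=
    (continuous_const.mul hf.continuous).add
      ((hf.continuous_fderiv (by simp)).clm_apply continuous_id)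
  have hint : ∀ {g : E n → ℝ}, Continuous g → IntegrableOn g (Metric.ball (0 : E n) 1) :=
    fun hg => (hg.continuousOn.integrableOn_compact (isCompact_closedBall 0 1)).mono_set
      Metric.ball_subset_closedBall
  simp_rw [hd]
  rw [integral_add (hint (continuous_divergence hG)) (hint hfd), h1, zero_add,
    integral_ball_radial hn hf, surface_restrict_sphere hn]

end Divergence

/-! ### Smooth functions and constant fields in the unit ball -/

section UnitBall

variable {n : ℕ}

lemma hasFDerivAt_norm_sq_sub_one (x : E n) :
    HasFDerivAt (fun y : E n => ‖y‖ ^ 2 - 1) (innerSL ℝ ((2 : ℝ) • x)) x := by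
  refine ((hasStrictFDerivAt_norm_sq x).hasFDerivAt.sub_const 1).congr_fderiv ?_
  ext v
  simp

lemma gradient_norm_sq_sub_one (x : E n) :
    gradient (fun y : E n => ‖y‖ ^ 2 - 1) x = (2 : ℝ) • x := by
  refine HasGradientAt.gradient ?_
  rw [hasGradientAt_iff_hasFDerivAt]
  refine (hasFDerivAt_norm_sq_sub_one x).congr_fderiv ?_
  ext v
  simp

/-- The unit ball. The Dirichlet part of its boundary is the equator orthogonal to `e`, the Neumann
part the rest of the sphere, so that a multiple of `⟪e, x⟫` satisfies the Dirichlet condition. -/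
noncomputable def unitBall (e : E n) : BoundaryDomain n where
  Ω := Metric.ball 0 1
  normal := fun x => x
  Γu := Metric.sphere 0 1 ∩ {x | ⟪e, x⟫ = 0}
  Γt := Metric.sphere 0 1 \ {x | ⟪e, x⟫ = 0}
  isOpen := Metric.isOpen_ball
  isConnected :=
    ((convex_ball (0 : E n) 1).isPathConnected (Metric.nonempty_ball.2 one_pos)).isConnected
  isBounded := Metric.isBounded_ball
  boundary := by
    intro x _
    refine ⟨univ, Filter.univ_mem, fun y => ‖y‖ ^ 2 - 1, (contDiff_norm_sq ℝ).sub contDiff_const,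
      fun y _ => ?_, ?_⟩
    · rw [mem_ball_zero_iff, sub_neg, sq_lt_one_iff₀ (norm_nonneg y)]
    · rintro y ⟨-, hy⟩
      rw [frontier_unitBall, mem_sphere_zero_iff_norm] at hy
      have hy0 : y ≠ 0 := by rintro rfl; simp at hy
      rw [gradient_norm_sq_sub_one, norm_smul, hy, smul_smul]
      refine ⟨by simp [hy], smul_ne_zero two_ne_zero hy0, ?_⟩
      norm_num
  measurableSet_Γu := Metric.isClosed_sphere.measurableSet.inter
    (isClosed_eq (by fun_prop) continuous_const).measurableSet
  measurableSet_Γt := Metric.isClosed_sphere.measurableSet.diff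
    (isClosed_eq (by fun_prop) continuous_const).measurableSet
  union_eq := by rw [frontier_unitBall, inter_union_sdiff]

lemma integrableOn_unitBall {g : E n → ℝ} (hg : Continuous g) :
    IntegrableOn g (Metric.ball (0 : E n) 1) :=
  (hg.continuousOn.integrableOn_compact (isCompact_closedBall 0 1)).mono_set
    Metric.ball_subset_closedBall

lemma memLp_surface_of_continuous (hn : 1 ≤ n) {g : E n → ℝ} (hg : Continuous g) (r : ℝ≥0∞)
    {S : Set (E n)} (hS : S ⊆ Metric.sphere 0 1) :
    MemLp g r ((surface n).restrict S) := by
  have := isFiniteMeasure_surface_sphere hn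
  obtain ⟨C, hC⟩ := (isCompact_sphere (0 : E n) 1).exists_bound_of_continuousOn hg.continuousOn
  have h : MemLp g r ((surface n).restrict (Metric.sphere 0 1)) :=
    .of_bound hg.aestronglyMeasurable C
      ((ae_restrict_iff' Metric.isClosed_sphere.measurableSet).2 (.of_forall hC))
  exact h.mono_measure (Measure.restrict_mono hS le_rfl)

lemma contDiff_gradient {u : E n → ℝ} (hu : ContDiff ℝ ∞ u) : ContDiff ℝ ∞ (gradient u) :=
  (InnerProductSpace.toDual ℝ (E n)).symm.contDiff.comp (hu.fderiv_right (by simp))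

lemma hasFDerivAt_innerSL_gradient {u : E n → ℝ} (hu : ContDiff ℝ ∞ u) (x : E n) :
    HasFDerivAt u (innerSL ℝ (gradient u x)) x := by
  have h := (hu.differentiable (by simp)).differentiableAt.hasGradientAt (x := x)
  rw [hasGradientAt_iff_hasFDerivAt] at h
  refine h.congr_fderiv ?_
  ext v
  simp

lemma fderiv_apply_eq_inner {u : E n → ℝ} (hu : ContDiff ℝ ∞ u) (x v : E n) :
    fderiv ℝ u x v = ⟪gradient u x, v⟫ := by
  rw [(hasFDerivAt_innerSL_gradient hu x).fderiv, innerSL_apply_apply]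

lemma integral_ball_smul (hn : 1 ≤ n) {η : E n → ℝ} {F : E n → E n} (hη : ContDiff ℝ ∞ η)
    (hF : ContDiff ℝ ∞ F) :
    ∫ x in Metric.ball (0 : E n) 1, (η x * divergence F x + fderiv ℝ η x (F x)) =
      ∫ x in Metric.sphere (0 : E n) 1, η x * ⟪F x, x⟫ ∂(surface n) := by
  have h := integral_ball_divergence hn (F := fun x => η x • F x)
    ((hη.smul hF).of_le (by simp))
  simp_rw [inner_smul_left, RCLike.conj_to_real] at h
  rw [← h]
  refine integral_congr_ae (.of_forall fun x => ?_)
  exact (divergence_smul (hη.differentiable (by simp)).differentiableAt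
    (hF.differentiable (by simp)).differentiableAt).symm

/-- A smooth function on `ℝⁿ` vanishing on the Dirichlet boundary, as an element of `𝓤₀` in the unit
ball with its classical gradient, Laplacian, trace and normal derivative. -/
noncomputable def smoothElement (hn : 1 ≤ n) (e : E n) (p q β : ℝ≥0∞) (u : E n → ℝ)
    (hu : ContDiff ℝ ∞ u) (hu0 : ∀ x ∈ (unitBall e).Γu, u x = 0) :
    SpaceU0 (unitBall e) p q β where
  toFun := u
  grad := gradient u
  trace := u
  memLp := memLp_of_continuousOn_closure _ hu.continuous.continuousOn p
  grad_memLp := memLp_of_continuousOn_closure _ (contDiff_gradient hu).continuous.continuousOn 4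
  isWeakGradient := isWeakGradient_of_hasFDerivAt (contDiff_gradient hu).continuous.continuousOn
    fun x _ => hasFDerivAt_innerSL_gradient hu x
  isTrace := by
    have hfr : frontier (unitBall e).Ω = Metric.sphere 0 1 := frontier_unitBall
    rw [IsTrace, hfr]
    refine ⟨memLp_one_iff_integrable.1 (memLp_surface_of_continuous hn hu.continuous 1 subset_rfl),
      fun φ hφ _ => ?_⟩
    refine Eq.trans ?_ (integral_ball_smul hn hu hφ)
    refine integral_congr_ae (.of_forall fun x => ?_)
    simp only [fderiv_apply_eq_inner hu]
  trace_eq_zero := (ae_restrict_iff' (unitBall e).measurableSet_Γu).2 (.of_forall hu0)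
  lap := divergence (gradient u)
  normalDeriv := fun x => ⟪gradient u x, x⟫
  isWeakLaplacian := by
    intro φ hφ _ hφΩ
    have hφ0 : ∀ x ∈ Metric.sphere (0 : E n) 1, φ x = 0 := fun x hx => by
      by_contra h
      have h1 := hφΩ (subset_tsupport φ h)
      change x ∈ Metric.ball 0 1 at h1
      simp only [mem_sphere_zero_iff_norm] at hx
      simp [hx] at h1
    have hG := contDiff_gradient hu
    have hG1 : ContDiff ℝ 1 (gradient u) := hG.of_le (by simp)
    have h := integral_ball_smul hn hφ hG
    have hz : ∫ x in Metric.sphere (0 : E n) 1, φ x * ⟪gradient u x, x⟫ ∂(surface n) = 0 :=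
      setIntegral_eq_zero_of_forall_eq_zero fun x hx => by rw [hφ0 x hx, zero_mul]
    have i1 : IntegrableOn (fun x => φ x * divergence (gradient u) x) (Metric.ball 0 1) :=
      integrableOn_unitBall (hφ.continuous.mul (continuous_divergence hG1))
    have i2 : IntegrableOn (fun x => fderiv ℝ φ x (gradient u x)) (Metric.ball 0 1) :=
      integrableOn_unitBall ((hφ.continuous_fderiv (by simp)).clm_apply hG.continuous)
    rw [hz, integral_add i1 i2] at h
    change ∫ x in Metric.ball (0 : E n) 1, _ = -∫ x in Metric.ball (0 : E n) 1, _
    simp_rw [mul_comm (divergence _ _)]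
    linarith
  lap_memLp := memLp_of_continuousOn_closure _
    (continuous_divergence ((contDiff_gradient hu).of_le (by simp))).continuousOn _
  isNormalDerivative := by
    have hG := contDiff_gradient hu
    have hc : Continuous fun x => ⟪gradient u x, x⟫ := hG.continuous.inner continuous_id
    refine ⟨memLp_one_iff_integrable.1 (memLp_surface_of_continuous hn hc 1 sdiff_subset),
      fun φ hφ _ hφd => ?_⟩
    have h := integral_ball_smul hn hφ hG
    refine Eq.trans ?_ (h.trans ?_)
    · refine integral_congr_ae (.of_forall fun x => ?_)
      simp only
      ring
    · rw [setIntegral_eq_of_subset_of_forall_sdiff_eq_zero (s := (unitBall e).Γt)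
        Metric.isClosed_sphere.measurableSet sdiff_subset]
      · refine integral_congr_ae (.of_forall fun x => ?_)
        simp only
        ring
      · rintro x ⟨hx, hxt⟩
        have hxu : x ∈ (unitBall e).Γu := by
          refine ⟨hx, ?_⟩
          by_contra h'
          exact hxt ⟨hx, h'⟩
        have : φ x = 0 := by
          by_contra h'
          exact (disjoint_left.1 hφd) (subset_tsupport φ h') hxu
        rw [this, zero_mul]
  normalDeriv_memLp := memLp_surface_of_continuous hn
    ((contDiff_gradient hu).continuous.inner continuous_id) β sdiff_subset
  trace_memLp := memLp_surface_of_continuous hn hu.continuous q sdiff_subset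

/-- A constant field `c e` solves the equilibrium equation without volume load in the unit ball, by
the trace formula with the field, cut off outside a neighbourhood of the ball, as test field. -/
lemma isData_const (hn : 1 ≤ n) (e : E n) (c : ℝ) (p q β : ℝ≥0∞) :
    IsData (unitBall e) p q β (fun _ => 0) (fun x => ⟪c • e, x⟫) (fun _ => c • e) where
  f_memLp := MemLp.zero
  t_memLp := memLp_surface_of_continuous hn (by fun_prop) _ sdiff_subset
  σ_continuousOn := continuousOn_const
  isEquilibrium := by
    intro v
    let χ : ContDiffBump (0 : E n) := ⟨2, 3, by norm_num, by norm_num⟩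
    have hfr : frontier (unitBall e).Ω = Metric.sphere 0 1 := frontier_unitBall
    have h := v.isTrace.2 (fun x => χ x • c • e) (χ.contDiff.smul contDiff_const)
      (χ.hasCompactSupport.smul_right (f' := fun _ : E n => c • e))
    have hball : ∀ x ∈ Metric.ball (0 : E n) 1, χ =ᶠ[𝓝 x] fun _ => 1 := fun x hx => by
      filter_upwards [Metric.isOpen_ball.mem_nhds hx] with y hy
      exact χ.one_of_mem_closedBall (Metric.ball_subset_closedBall
        (Metric.ball_subset_ball (show (1 : ℝ) ≤ 2 by norm_num) hy))
    have hL : ∫ x in (unitBall e).Ω, (v.toFun x * divergence (fun x => χ x • c • e) x +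
        ⟪v.grad x, χ x • c • e⟫) = ∫ x in (unitBall e).Ω, ⟪c • e, v.grad x⟫ := by
      refine setIntegral_congr_fun (unitBall e).isOpen.measurableSet fun x hx => ?_
      have h1 := hball x hx
      have h2 : (fun x => χ x • c • e) =ᶠ[𝓝 x] fun _ => c • e := by
        filter_upwards [h1] with y hy
        rw [hy, one_smul]
      have h3 : divergence (fun x => χ x • c • e) x = 0 := by
        simp [divergence, h2.fderiv_eq]
      simp only [h3, h1.eq_of_nhds, one_smul, mul_zero, zero_add]
      exact real_inner_comm _ _
    have hR : ∫ x in frontier (unitBall e).Ω, v.trace x * ⟪χ x • c • e, (unitBall e).normal x⟫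
        ∂(surface n) = ∫ x in (unitBall e).Γt, ⟪c • e, x⟫ * v.trace x ∂(surface n) := by
      rw [hfr, ← setIntegral_eq_of_subset_of_forall_sdiff_eq_zero (s := (unitBall e).Γt)
        Metric.isClosed_sphere.measurableSet sdiff_subset (f := fun x => ⟪c • e, x⟫ * v.trace x)]
      · refine setIntegral_congr_fun Metric.isClosed_sphere.measurableSet fun x hx => ?_
        have h1 : χ x = 1 := χ.one_of_mem_closedBall (by
          rw [mem_closedBall_zero_iff]
          rw [mem_sphere_zero_iff_norm] at hx
          rw [hx]; exact one_le_two)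
        simp only [h1, one_smul]
        exact mul_comm _ _
      · rintro x ⟨hx, hxt⟩
        have : ⟪e, x⟫ = 0 := by
          by_contra h'
          exact hxt ⟨hx, h'⟩
        rw [inner_smul_left, this]
        simp
    rw [hL, hR] at h
    rw [h]
    simp

lemma isPathIntegral_inner {Ω : Set (E n)} {σ : E n → E n} {ζ : E n → ℝ} {a : E n}
    (h : ∀ x, (ζ x)⁻¹ • σ x = a) : IsPathIntegral Ω σ ζ fun x => ⟪a, x⟫ := by
  intro x₀ x γ hγ _
  rw [curveIntegral_def]
  simp_rw [curveIntegralFun_def, h]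
  have h1 : ContDiffOn ℝ 1 (fun t => ⟪a, γ.extend t⟫) (Icc 0 1) := contDiffOn_const.inner ℝ hγ
  have h2 := intervalIntegral.integral_derivWithin_Icc_of_contDiffOn_Icc h1 zero_le_one
  have h3 : ∫ t in (0 : ℝ)..1, innerSL ℝ a (derivWithin γ.extend (Icc 0 1) t) =
      ∫ t in (0 : ℝ)..1, derivWithin (fun t => ⟪a, γ.extend t⟫) (Icc 0 1) t := by
    refine intervalIntegral.integral_congr fun t ht => ?_
    rw [uIcc_of_le zero_le_one] at ht
    have h4 := ((hγ.differentiableOn (by simp)) t ht).hasDerivWithinAt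
    exact (((innerSL ℝ a).hasFDerivAt.comp_hasDerivWithinAt t h4).derivWithin
      (uniqueDiffOn_Icc_zero_one t ht)).symm
  rw [h3, h2, γ.extend_one, γ.extend_zero]
  ring

lemma isSimplyConnected_ball : IsSimplyConnected (Metric.ball (0 : E n) 1) := by
  have : ContractibleSpace (Metric.ball (0 : E n) 1) :=
    (convex_ball (0 : E n) 1).contractibleSpace (Metric.nonempty_ball.2 one_pos)
  exact SimplyConnectedSpace.ofContractible _

end UnitBall

/-! ### An unstable affine critical point -/

section Instability

variable {n : ℕ}

/-- In dimension at least two, some test function has at most half of its Dirichlet energy in one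
coordinate direction. -/
lemma exists_test_function_inner_gradient (hn : 2 ≤ n) : ∃ (φ : E n → ℝ) (i : Fin n),
    ContDiff ℝ ∞ φ ∧ (∀ x ∈ Metric.sphere (0 : E n) 1, φ x = 0) ∧
    0 < ∫ x in Metric.ball (0 : E n) 1, ‖gradient φ x‖ ^ 2 ∧
    2 * ∫ x in Metric.ball (0 : E n) 1, ⟪EuclideanSpace.single i (1 : ℝ), gradient φ x⟫ ^ 2 ≤
      ∫ x in Metric.ball (0 : E n) 1, ‖gradient φ x‖ ^ 2 := by
  let φ : ContDiffBump (0 : E n) := ⟨1 / 4, 1 / 2, by norm_num, by norm_num⟩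
  have hφ : ContDiff ℝ ∞ φ := φ.contDiff
  have hg := (contDiff_gradient hφ).continuous
  have hts : ∀ x ∉ Metric.ball (0 : E n) 1, x ∉ tsupport φ := fun x hx h => hx <| by
    rw [φ.tsupport_eq] at h
    exact Metric.closedBall_subset_ball (show (1 / 2 : ℝ) < 1 by norm_num) h
  have hφ0 : ∀ x ∉ Metric.ball (0 : E n) 1, φ x = 0 := fun x hx =>
    image_eq_zero_of_notMem_tsupport (hts x hx)
  have hfd : ∀ x, fderiv ℝ φ x = innerSL ℝ (gradient φ x) := fun x =>
    (hasFDerivAt_innerSL_gradient hφ x).fderiv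
  have hg0 : ∀ x, fderiv ℝ φ x = 0 → gradient φ x = 0 := fun x hx => by
    rw [gradient, hx, map_zero]
  have hpos : 0 < ∫ x in Metric.ball (0 : E n) 1, ‖gradient φ x‖ ^ 2 := by
    rw [setIntegral_eq_integral_of_forall_compl_eq_zero fun x hx => by
      rw [hg0 x (image_eq_zero_of_notMem_tsupport
        fun h => hts x hx (tsupport_fderiv_subset ℝ h))]; simp]
    obtain ⟨x, hx⟩ : ∃ x, ‖gradient φ x‖ ^ 2 ≠ 0 := by
      by_contra! h
      have h1 : ∀ x, fderiv ℝ φ x = 0 := fun x => by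
        rw [hfd, norm_eq_zero.1 (pow_eq_zero_iff two_ne_zero |>.1 (h x)), map_zero]
      have h2 := is_const_of_fderiv_eq_zero (hφ.differentiable (by simp)) h1 0
        (EuclideanSpace.single ⟨0, by lia⟩ 1)
      rw [hφ0 (EuclideanSpace.single ⟨0, by lia⟩ 1) (by simp), φ.one_of_mem_closedBall
        (Metric.mem_closedBall_self (by norm_num [φ]))] at h2
      exact one_ne_zero h2
    refine (hg.norm.pow 2).integral_pos_of_hasCompactSupport_nonneg_nonzero
      ((φ.hasCompactSupport.fderiv ℝ).mono fun x h => ?_) (fun x => sq_nonneg _) hx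
    contrapose! h
    simp only [Function.mem_support, not_not] at h ⊢
    simp [hg0 x h]
  have hint : ∀ i : Fin n, IntegrableOn
      (fun x => ⟪EuclideanSpace.single i (1 : ℝ), gradient φ x⟫ ^ 2) (Metric.ball 0 1) := fun i =>
    integrableOn_unitBall ((continuous_const.inner hg).pow 2)
  have hne : (⟨0, by lia⟩ : Fin n) ≠ ⟨1, by lia⟩ := by simp
  have hsum : (∫ x in Metric.ball (0 : E n) 1,
        ⟪EuclideanSpace.single (⟨0, by lia⟩ : Fin n) (1 : ℝ), gradient φ x⟫ ^ 2) +
      ∫ x in Metric.ball (0 : E n) 1,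
        ⟪EuclideanSpace.single (⟨1, by lia⟩ : Fin n) (1 : ℝ), gradient φ x⟫ ^ 2 ≤
      ∫ x in Metric.ball (0 : E n) 1, ‖gradient φ x‖ ^ 2 := by
    rw [← integral_add (hint _) (hint _)]
    refine integral_mono ((hint _).add (hint _)) (integrableOn_unitBall (hg.norm.pow 2))
      fun x => ?_
    simp only [EuclideanSpace.inner_single_left, map_one, one_mul]
    rw [EuclideanSpace.real_norm_sq_eq, ← Finset.sum_pair hne
      (f := fun i => gradient φ x i ^ 2)]
    exact Finset.sum_le_sum_of_subset_of_nonneg (Finset.subset_univ _)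
      fun _ _ _ => sq_nonneg _
  have hsph : ∀ x ∈ Metric.sphere (0 : E n) 1, x ∉ Metric.ball (0 : E n) 1 := fun x hx =>
    disjoint_left.1 Metric.sphere_disjoint_ball hx
  obtain h | h := le_total
    (∫ x in Metric.ball (0 : E n) 1,
      ⟪EuclideanSpace.single (⟨0, by lia⟩ : Fin n) (1 : ℝ), gradient φ x⟫ ^ 2)
    (∫ x in Metric.ball (0 : E n) 1,
      ⟪EuclideanSpace.single (⟨1, by lia⟩ : Fin n) (1 : ℝ), gradient φ x⟫ ^ 2)
  · exact ⟨φ, ⟨0, by lia⟩, hφ, fun x hx => hφ0 x (hsph x hx), hpos, by linarith⟩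
  · exact ⟨φ, ⟨1, by lia⟩, hφ, fun x hx => hφ0 x (hsph x hx), hpos, by linarith⟩

/-- The energy of a perturbation of an affine critical point, as a polynomial in the size of the
perturbation. -/
lemma energy_smoothElement (hn : 1 ≤ n) {e : E n} {c ν lam z : ℝ} {p q β : ℝ≥0∞} (hν : 0 < ν)
    (hz : z ≠ 0) (h : DAE ν lam (c • e) z) {φ u : E n → ℝ} (hφ : ContDiff ℝ ∞ φ)
    (hu : ContDiff ℝ ∞ u) (hu0 : ∀ x ∈ (unitBall e).Γu, u x = 0) (ε : ℝ)
    (hgrad : ∀ x, gradient u x = z⁻¹ • c • e + ε • gradient φ x) :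
    energy ν lam (fun _ => 0) (fun x => ⟪c • e, x⟫) (smoothElement hn e p q β u hu hu0) =
      (∫ _x in Metric.ball (0 : E n) 1, dualDensity ν lam (c • e) z) +
      ε ^ 2 / 2 * (z * (∫ x in Metric.ball (0 : E n) 1, ‖gradient φ x‖ ^ 2) +
        ν * (∫ x in Metric.ball (0 : E n) 1, ⟪z⁻¹ • c • e, gradient φ x⟫ ^ 2) +
        ε * (ν * ∫ x in Metric.ball (0 : E n) 1, ⟪z⁻¹ • c • e, gradient φ x⟫ * ‖gradient φ x‖ ^ 2) +
        ε ^ 2 * (ν / 4 * ∫ x in Metric.ball (0 : E n) 1, ‖gradient φ x‖ ^ 4)) := by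
  rw [energy_eq (isData_const hn e c p q β)]
  have hg := (contDiff_gradient hφ).continuous
  have hi : Continuous fun x => ⟪z⁻¹ • c • e, gradient φ x⟫ := continuous_const.inner hg
  have i1 : IntegrableOn (fun x => ‖gradient φ x‖ ^ 2) (Metric.ball 0 1) :=
    integrableOn_unitBall (hg.norm.pow 2)
  have i2 : IntegrableOn (fun x => ⟪z⁻¹ • c • e, gradient φ x⟫ ^ 2) (Metric.ball 0 1) :=
    integrableOn_unitBall (hi.pow 2)
  have i3 : IntegrableOn (fun x => ⟪z⁻¹ • c • e, gradient φ x⟫ * ‖gradient φ x‖ ^ 2)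
      (Metric.ball 0 1) := integrableOn_unitBall (hi.mul (hg.norm.pow 2))
  have i4 : IntegrableOn (fun x => ‖gradient φ x‖ ^ 4) (Metric.ball 0 1) :=
    integrableOn_unitBall (hg.norm.pow 4)
  have i0 := integrableOn_unitBall (n := n)
    (continuous_const (y := dualDensity ν lam (c • e) z))
  have hpt : ∀ x, W ν lam (gradient u x) - ⟪c • e, gradient u x⟫ =
      dualDensity ν lam (c • e) z + (z * ε ^ 2 / 2 * ‖gradient φ x‖ ^ 2 +
      (ν * ε ^ 2 / 2 * ⟪z⁻¹ • c • e, gradient φ x⟫ ^ 2 +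
      (ν * ε ^ 3 / 2 * (⟪z⁻¹ • c • e, gradient φ x⟫ * ‖gradient φ x‖ ^ 2) +
      ν * ε ^ 4 / 8 * ‖gradient φ x‖ ^ 4))) := fun x => by
    rw [hgrad, W_expansion hν hz h, norm_smul, inner_smul_right, mul_pow, Real.norm_eq_abs, sq_abs]
    ring
  change ∫ x in Metric.ball (0 : E n) 1, (W ν lam (gradient u x) - ⟪c • e, gradient u x⟫) = _
  simp_rw [hpt]
  have j4 := i4.const_mul (ν * ε ^ 4 / 8)
  have j3 := i3.const_mul (ν * ε ^ 3 / 2)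
  have j2 := i2.const_mul (ν * ε ^ 2 / 2)
  have j1 := i1.const_mul (z * ε ^ 2 / 2)
  rw [integral_add i0 (j1.fun_add (j2.fun_add (j3.fun_add j4))),
    integral_add j1 (j2.fun_add (j3.fun_add j4)), integral_add j2 (j3.fun_add j4),
    integral_add j3 j4]
  simp_rw [integral_const_mul]
  ring

/-- An affine critical point on the middle branch with
`ζ = -(3/5) ν lam`, `|∇u|² = 4 lam / 5` is unstable: a perturbation `ε φ` changes the energy by
`ε²/2 · ∫ (ζ |∇φ|² + ν ⟨∇u, ∇φ⟩²) + O(ε³)`, which is negative when the direction of `∇u` carries at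
most half of the Dirichlet energy of `φ`. The factor `3/5` lies between `1/2`, from where on this
works, and `2/3`, the end of the middle branch. -/
lemma exists_middle_branch_not_local_min (hn : 2 ≤ n) {ν lam : ℝ} (hν : 0 < ν) (hlam : 0 < lam)
    (p q β : ℝ≥0∞) :
    ∃ (D : BoundaryDomain n) (f t : E n → ℝ) (σ : E n → E n),
      IsSimplyConnected D.Ω ∧ IsData D p q β f t σ ∧
      (∀ x ∈ closure D.Ω, 0 < ‖σ x‖ ^ 2 ∧ ‖σ x‖ ^ 2 < 8 * lam ^ 3 * ν ^ 2 / 27) ∧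
      ∃ ζ₂ : E n → ℝ,
        (∀ x ∈ closure D.Ω, DAE ν lam (σ x) (ζ₂ x) ∧
          -(2 * ν * lam / 3) < ζ₂ x ∧ ζ₂ x < 0) ∧
        ∃ u₂ : SpaceU0 D p q β, IsPathIntegral D.Ω σ ζ₂ u₂.toFun ∧
          ¬ IsWeakLocalMin ν lam f t u₂ := by
  have hn1 : 1 ≤ n := by lia
  obtain ⟨φ, i, hφ, hφ0, hJ, hJi⟩ := exists_test_function_inner_gradient hn
  set e : E n := EuclideanSpace.single i (1 : ℝ) with he
  set α : ℝ := √(4 * lam / 5) with hα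
  have hα2 : α ^ 2 = 4 * lam / 5 := Real.sq_sqrt (by positivity)
  set z : ℝ := -(3 / 5 * (ν * lam)) with hz
  have hνl : 0 < ν * lam := mul_pos hν hlam
  have hz0 : z < 0 := by rw [hz]; linarith
  have ha : z⁻¹ • (z * α) • e = α • e := by
    rw [smul_smul, inv_mul_cancel_left₀ hz0.ne]
  have hσ : ‖(z * α) • e‖ ^ 2 = 36 / 125 * (ν ^ 2 * lam ^ 3) := by
    rw [norm_smul, he, PiLp.norm_single, norm_one, mul_one, Real.norm_eq_abs, sq_abs, mul_pow, hα2,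
      hz]
    ring
  have hDAE : DAE ν lam ((z * α) • e) z := by
    rw [DAE, hσ, hz]
    field_simp
    norm_num
  have hu : ContDiff ℝ ∞ fun x : E n => ⟪α • e, x⟫ := contDiff_const.inner ℝ contDiff_id
  have hu0 : ∀ x ∈ (unitBall e).Γu, ⟪α • e, x⟫ = 0 := fun x hx => by
    rw [inner_smul_left, show ⟪e, x⟫ = 0 from hx.2, mul_zero]
  have hgu : ∀ x, HasFDerivAt (fun x : E n => ⟪α • e, x⟫) (innerSL ℝ (α • e)) x := fun x =>
    (innerSL ℝ (α • e)).hasFDerivAt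
  have hgrad : ∀ {v : E n → ℝ} {x y : E n}, HasFDerivAt v (innerSL ℝ y) x →
      gradient v x = y := fun {v x y} h => by
    refine HasGradientAt.gradient ?_
    rw [hasGradientAt_iff_hasFDerivAt]
    refine h.congr_fderiv ?_
    ext w
    simp
  refine ⟨unitBall e, fun _ => 0, fun x => ⟪(z * α) • e, x⟫, fun _ => (z * α) • e,
    isSimplyConnected_ball, isData_const hn1 e _ p q β, fun _ _ => ?_, fun _ => z,
    fun _ _ => ⟨hDAE, by rw [hz]; linarith, hz0⟩,
    smoothElement hn1 e p q β _ hu hu0, isPathIntegral_inner fun _ => ha, ?_⟩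
  · have : 0 < ν ^ 2 * lam ^ 3 := by positivity
    rw [hσ]
    exact ⟨by positivity, by linarith⟩
  rintro ⟨δ, hδ, hmin⟩
  have hA : z * (∫ x in Metric.ball (0 : E n) 1, ‖gradient φ x‖ ^ 2) +
      ν * (∫ x in Metric.ball (0 : E n) 1, ⟪α • e, gradient φ x⟫ ^ 2) < 0 := by
    simp_rw [real_inner_smul_left, mul_pow, hα2, integral_const_mul]
    rw [hz]
    nlinarith [mul_pos hνl hJ, mul_le_mul_of_nonneg_left hJi hνl.le]
  obtain ⟨C, hC⟩ := (isCompact_closedBall (0 : E n) 1).exists_bound_of_continuousOn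
    hφ.continuous.continuousOn
  obtain ⟨C', hC'⟩ := (isCompact_closedBall (0 : E n) 1).exists_bound_of_continuousOn
    (contDiff_gradient hφ).continuous.continuousOn
  set K := ν * ∫ x in Metric.ball (0 : E n) 1, ⟪α • e, gradient φ x⟫ * ‖gradient φ x‖ ^ 2
  set M := ν / 4 * ∫ x in Metric.ball (0 : E n) 1, ‖gradient φ x‖ ^ 4
  set A := z * (∫ x in Metric.ball (0 : E n) 1, ‖gradient φ x‖ ^ 2) +
      ν * (∫ x in Metric.ball (0 : E n) 1, ⟪α • e, gradient φ x⟫ ^ 2)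
  have e1 : ∀ᶠ ε : ℝ in 𝓝 0, A + ε * K + ε ^ 2 * M < 0 :=
    (show Continuous fun ε : ℝ => A + ε * K + ε ^ 2 * M by fun_prop).continuousAt.eventually_lt
      continuousAt_const (by simpa using hA)
  have e2 : ∀ c : ℝ, ∀ᶠ ε : ℝ in 𝓝 0, ε * c < δ := fun c =>
    (show Continuous fun ε : ℝ => ε * c by fun_prop).continuousAt.eventually_lt
      continuousAt_const (by simpa using hδ)
  have e3 : ∀ᶠ ε : ℝ in 𝓝[>] 0, 0 < ε := self_mem_nhdsWithin
  obtain ⟨ε, ⟨h1, h2, h3⟩, hε⟩ := (((e1.and ((e2 C).and (e2 C'))).filter_mono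
    nhdsWithin_le_nhds).and e3).exists
  have hw : ContDiff ℝ ∞ fun x : E n => ⟪α • e, x⟫ + ε * φ x := hu.add (contDiff_const.mul hφ)
  have hw0 : ∀ x ∈ (unitBall e).Γu, ⟪α • e, x⟫ + ε * φ x = 0 := fun x hx => by
    rw [hu0 x hx, hφ0 x hx.1, mul_zero, add_zero]
  have hgw : ∀ x, gradient (fun x : E n => ⟪α • e, x⟫ + ε * φ x) x = α • e + ε • gradient φ x :=
    fun x => hgrad (((hgu x).add ((hasFDerivAt_innerSL_gradient hφ x).const_mul ε)).congr_fderiv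
      (by rw [map_add, map_smul _ ε]))
  have hball : ∀ x ∈ (unitBall e).Ω, x ∈ Metric.closedBall (0 : E n) 1 := fun x hx =>
    Metric.ball_subset_closedBall hx
  have key := hmin (smoothElement hn1 e p q β _ hw hw0) <| by
    refine (ae_restrict_iff' (unitBall e).isOpen.measurableSet).2 (.of_forall fun x hx => ⟨?_, ?_⟩)
    · change |⟪α • e, x⟫ + ε * φ x - ⟪α • e, x⟫| < δ
      rw [add_sub_cancel_left, abs_mul, abs_of_pos hε]
      exact (mul_le_mul_of_nonneg_left (hC x (hball x hx)) hε.le).trans_lt h2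
    · change ‖gradient (fun x : E n => ⟪α • e, x⟫ + ε * φ x) x -
        gradient (fun x : E n => ⟪α • e, x⟫) x‖ < δ
      rw [hgw, hgrad (hgu x), add_sub_cancel_left, norm_smul, Real.norm_eq_abs, abs_of_pos hε]
      exact (mul_le_mul_of_nonneg_left (hC' x (hball x hx)) hε.le).trans_lt h3
  rw [energy_smoothElement hn1 hν hz0.ne hDAE hφ hu hu0 0
      (fun x => by rw [hgrad (hgu x), ha, zero_smul, add_zero]),
    energy_smoothElement hn1 hν hz0.ne hDAE hφ hw hw0 ε (fun x => by rw [hgw, ha]), ha] at key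
  have : 0 < ε ^ 2 / 2 := by positivity
  have h4 := mul_neg_of_pos_of_neg this h1
  simp only [ne_eq, OfNat.ofNat_ne_zero, not_false_eq_true, zero_pow, zero_div, zero_mul,
    add_zero] at key
  exact lt_irrefl _ (key.trans_lt (add_lt_of_neg_right _ h4))

end Instability

end DoubleWell

theorem theorem2p4 (n : ℕ) (hn : 1 ≤ n) (ν lam : ℝ) (hν : 0 < ν) (hlam : 0 < lam)
    (p q β : ℝ≥0∞) (hp : 2 ≤ p) (hq : 2 ≤ q) (hβ : 2 ≤ β) :
    (∀ (D : DoubleWell.BoundaryDomain n) (f t : DoubleWell.E n → ℝ)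
        (σ : DoubleWell.E n → DoubleWell.E n),
      DoubleWell.IsData D p q β f t σ →
      -- the case of one real root
      ((∀ x ∈ closure D.Ω, 8 * lam ^ 3 * ν ^ 2 / 27 < ‖σ x‖ ^ 2) →
        ∃ ζ : DoubleWell.E n → ℝ,
          (∀ x ∈ closure D.Ω, 0 < ζ x ∧ ∀ z : ℝ, DoubleWell.DAE ν lam (σ x) z ↔ z = ζ x) ∧
          ζ ∈ DoubleWell.dualSet D (Ici 0) ∧
          IsMaxOn (DoubleWell.dualEnergy D ν lam σ) (DoubleWell.dualSet D (Ici 0)) ζ ∧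
          ∀ ubar : DoubleWell.SpaceU0 D p q β,
            DoubleWell.IsPathIntegral D.Ω σ ζ ubar.toFun →
            (∀ u : DoubleWell.SpaceU0 D p q β,
              DoubleWell.energy ν lam f t ubar ≤ DoubleWell.energy ν lam f t u) ∧
            (DoubleWell.energy ν lam f t ubar : EReal) = DoubleWell.dualEnergy D ν lam σ ζ) ∧
      -- the case of three real roots
      ((∀ x ∈ closure D.Ω, 0 < ‖σ x‖ ^ 2 ∧ ‖σ x‖ ^ 2 < 8 * lam ^ 3 * ν ^ 2 / 27) →
        ∃ ζ₁ ζ₂ ζ₃ : DoubleWell.E n → ℝ,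
          (∀ x ∈ closure D.Ω,
            (0 < ζ₁ x ∧ ζ₂ x < 0 ∧ -(2 * ν * lam / 3) < ζ₂ x ∧ ζ₃ x < -(2 * ν * lam / 3) ∧
              -(ν * lam) < ζ₃ x) ∧
            ∀ z : ℝ, DoubleWell.DAE ν lam (σ x) z ↔ z = ζ₁ x ∨ z = ζ₂ x ∨ z = ζ₃ x) ∧
          -- the largest root
          (ζ₁ ∈ DoubleWell.dualSet D (Ioi 0) ∧
            IsMaxOn (DoubleWell.dualEnergy D ν lam σ) (DoubleWell.dualSet D (Ioi 0)) ζ₁ ∧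
            ∀ u₁ : DoubleWell.SpaceU0 D p q β,
              DoubleWell.IsPathIntegral D.Ω σ ζ₁ u₁.toFun →
              (∀ u : DoubleWell.SpaceU0 D p q β,
                DoubleWell.energy ν lam f t u₁ ≤ DoubleWell.energy ν lam f t u) ∧
              (DoubleWell.energy ν lam f t u₁ : EReal) = DoubleWell.dualEnergy D ν lam σ ζ₁) ∧
          -- the smallest root
          (ζ₃ ∈ DoubleWell.dualSet D (Ioo (-(ν * lam)) (-(2 * ν * lam / 3))) ∧
            IsMaxOn (DoubleWell.dualEnergy D ν lam σ)
              (DoubleWell.dualSet D (Ioo (-(ν * lam)) (-(2 * ν * lam / 3)))) ζ₃ ∧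
            ∀ u₃ : DoubleWell.SpaceU0 D p q β,
              DoubleWell.IsPathIntegral D.Ω σ ζ₃ u₃.toFun →
              DoubleWell.IsWeakLocalMax ν lam f t u₃ ∧
              (DoubleWell.energy ν lam f t u₃ : EReal) = DoubleWell.dualEnergy D ν lam σ ζ₃) ∧
          -- the middle root, in dimension one
          (n = 1 →
            ζ₂ ∈ DoubleWell.dualSet D (Ioo (-(2 * ν * lam / 3)) 0) ∧
            IsMinOn (DoubleWell.dualEnergy D ν lam σ)
              (DoubleWell.dualSet D (Ioo (-(2 * ν * lam / 3)) 0)) ζ₂ ∧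
            ∀ u₂ : DoubleWell.SpaceU0 D p q β,
              DoubleWell.IsPathIntegral D.Ω σ ζ₂ u₂.toFun →
              DoubleWell.IsWeakLocalMin ν lam f t u₂ ∧
              (DoubleWell.energy ν lam f t u₂ : EReal) = DoubleWell.dualEnergy D ν lam σ ζ₂))) ∧
    -- the middle root, in higher dimension
    (2 ≤ n →
      ∃ (D : DoubleWell.BoundaryDomain n) (f t : DoubleWell.E n → ℝ)
        (σ : DoubleWell.E n → DoubleWell.E n),
        IsSimplyConnected D.Ω ∧ DoubleWell.IsData D p q β f t σ ∧
        (∀ x ∈ closure D.Ω, 0 < ‖σ x‖ ^ 2 ∧ ‖σ x‖ ^ 2 < 8 * lam ^ 3 * ν ^ 2 / 27) ∧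
        ∃ ζ₂ : DoubleWell.E n → ℝ,
          (∀ x ∈ closure D.Ω, DoubleWell.DAE ν lam (σ x) (ζ₂ x) ∧
            -(2 * ν * lam / 3) < ζ₂ x ∧ ζ₂ x < 0) ∧
          ∃ u₂ : DoubleWell.SpaceU0 D p q β,
            DoubleWell.IsPathIntegral D.Ω σ ζ₂ u₂.toFun ∧
            ¬ DoubleWell.IsWeakLocalMin ν lam f t u₂) :=
  ⟨fun _ _ _ _ h => ⟨fun hσ => DoubleWell.one_root_case h hν hlam hσ,
      fun hσ => DoubleWell.three_roots_case h hν hlam hσ⟩,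
    fun hn2 => DoubleWell.exists_middle_branch_not_local_min hn2 hν hlam p q β⟩
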